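/- All vector spaces are finite-dimensional and real. A linear $2$-groupoid is a simplicial vector space $V_\bullet$, with faces $f_i$ and degeneracies $\sigma_i$, whose horn maps $\lambda_{q,k}\colon V_q\to\Lambda_{q,k}V$ are surjective for $q\ge 1$ and bijective for $q>2$. A constant symplectic $2$-groupoid is a linear $2$-groupoid $V_\bullet$ with an alternating bilinear form $\omega$ on $V_2$ (a constant, hence closed, $2$-form) that is - multiplicative: $\sum_{i=0}^{3}(-1)^i f_i^*\omega=0$ on $V_3$; - normalized: $\sigma_0^*\omega=\sigma_1^*\omega=0$ on $V_1$; - simplicially nondegenerate: the pairing of $V_0$ with $V_2/(\sigma_0V_1+\sigma_1V_1)$ induced by $A_\omega(v,w)=\omega(\sigma_0\sigma_0v,w)$ and the symmetric form on $V_1/\sigma_0V_0$ induced by $B_\omega(\theta,\eta)=\omega(\sigma_1\theta,\sigma_0\eta)+\omega(\sigma_1\eta,\sigma_0\theta)$ are nondegenerate. Its associated complex is $W_2\xrightarrow{\partial_2}W_1\xrightarrow{\partial_1}W_0$ with $W_0=V_0$, $W_1=\ker (f_0\colon V_1\to V_0)$, $W_2=\ker (f_0,f_1)\subseteq V_2$,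 $\partial_1=-f_1$, $\partial_2=f_2$. Identify $W_2\oplus W_1\oplus W_1\oplus W_0$ with $V_2$ by $$(w_2,w_1,w_1',w_0)\mapsto w_2+\sigma_0(w_1+\sigma_0w_0)+\sigma_1(w_1'-w_1),$$ and put $C_{41}(w_0,w_2)=\omega((0,0,0,w_0),(w_2,0,0,0))$ and $C_{32}(w,w')=\omega((0,0,w,0),(0,w',0,0))$. **Theorem 3.5.** Constant symplectic $2$-groupoids are in one-to-one correspondence with tuples $(W_1,W_0,\langle\cdot,\cdot\rangle,\partial,r)$, where $W_1,W_0$ are vector spaces, $\langle\cdot,\cdot\rangle$ is a nondegenerate symmetric bilinear form on $W_1$, $\partial\colon W_1\to W_0$ is a linear map such that the image of $\partial^*\colon W_0^*\to W_1^*\cong W_1$ is isotropic, and $r\in\wedge^2W_1^*$. Here a constant symplectic $2$-groupoid corresponds to a tuple if there is an isomorphism (a *presentation*) of its associated complex with $$W_0^*\xrightarrow{\partial^*}W_1\xrightarrow{\partial}W_0$$ that carries $C_{41}$ to the canonical pairing of $W_0$ with $W_0^*$ and $C_{32}$ to $\tfrac12\langle\cdot,\cdot\rangle+r$. Precisely: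 1. This relation is the graph of a bijection from isomorphism classes of constant symplectic $2$-groupoids (isomorphisms of simplicial vector spaces preserving $\omega$) to isomorphism classes of tuples (pairs of linear isomorphisms of $W_1$ and of $W_0$ preserving $\langle\cdot,\cdot\rangle$, $\partial$ and $r$). 2. Given presentations of $X$ by $S$ and of $Y$ by $T$, every isomorphism $S\to T$ is induced by exactly one isomorphism $X\to Y$, and every isomorphism $X\to Y$ induces exactly one isomorphism $S\to T$; here "induces" means that the two agree on $W_0$ and $W_1$ under the presentations. -/

import Mathlib

open CategoryTheory Opposite
open scoped Simplicial

universe u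

namespace ConstSymplectic

/-! ### Simplicial vector spaces and linear `n`-groupoids -/

/-- Simplicial real vector spaces. -/
abbrev SimplicialVS : Type (u + 1) := SimplicialObject (ModuleCat.{u} ℝ)

/-- The face map `f_i : V_{q+1} → V_q`. -/
abbrev face (V : SimplicialVS.{u}) {q : ℕ} (i : Fin (q + 2)) : V _⦋q + 1⦌ →ₗ[ℝ] V _⦋q⦌ :=
  (V.δ i).hom

/-- The degeneracy map `σ_i : V_q → V_{q+1}`. -/
abbrev degen (V : SimplicialVS.{u}) {q : ℕ} (i : Fin (q + 1)) : V _⦋q⦌ →ₗ[ℝ] V _⦋q + 1⦌ :=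
  (V.σ i).hom

/-- The horn compatibility equations for a tuple `(x_i)_{i ≠ k}` of elements of `V_q`, i.e. for a
`(q + 1, k)`-horn: `f_a x_b = f_{b-1} x_a` for all `a < b` different from `k`.  Below `a` is
`i.castSucc` and `b` is `j.succ`, so that `a < b` says `i ≤ j`.  There is no equation if `q = 0`. -/
def IsHorn (V : SimplicialVS.{u}) (q : ℕ) (k : Fin (q + 2))
    (x : {i : Fin (q + 2) // i ≠ k} → V _⦋q⦌) : Prop :=
  match q, k, x with
  | 0, _, _ => True
  | m + 1, k, x => ∀ (i j : Fin (m + 2)) (hi : i.castSucc ≠ k) (hj : j.succ ≠ k), i ≤ j →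
      face V i (x ⟨j.succ, hj⟩) = face V j (x ⟨i.castSucc, hi⟩)

/-- A linear `n`-groupoid: a Lie `n`-groupoid all of whose levels are (finite-dimensional) vector
spaces and all of whose structure maps are linear.  The horn maps
`x ↦ (f_i x)_{i ≠ k}` from `V_{q+1}` to the space of `(q + 1, k)`-horns are linear, so they are
surjective submersions as soon as they are surjective, and diffeomorphisms as soon as they are
bijective.  (Faces are surjective, hence submersions, and degeneracies are injective, hence
embeddings, because of the simplicial identities.) -/
structure IsLinearGroupoid (n : ℕ) (V : SimplicialVS.{u}) : Prop where
  finiteDimensional : ∀ q : ℕ, FiniteDimensional ℝ (V _⦋q⦌)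
  horn_surjective : ∀ (q : ℕ) (k : Fin (q + 2)) (x : {i : Fin (q + 2) // i ≠ k} → V _⦋q⦌),
    IsHorn V q k x → ∃ y : V _⦋q + 1⦌, ∀ i, face V i.1 y = x i
  horn_bijective : ∀ q : ℕ, n < q + 1 → ∀ (k : Fin (q + 2))
    (x : {i : Fin (q + 2) // i ≠ k} → V _⦋q⦌),
    IsHorn V q k x → ∃! y : V _⦋q + 1⦌, ∀ i, face V i.1 y = x i

/-! ### Constant 2-forms

A constant 2-form on a vector space is an alternating bilinear form.  It is automatically closed,
and pulling it back along a linear map is composing it with the map in both arguments. -/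

/-- The simplicial coboundary `δ ω = ∑ i, (-1)^i f_i^* ω`. -/
noncomputable def coboundary (V : SimplicialVS.{u}) {q : ℕ} (ω : LinearMap.BilinForm ℝ (V _⦋q⦌)) :
    LinearMap.BilinForm ℝ (V _⦋q + 1⦌) :=
  ∑ i : Fin (q + 2), (-1 : ℝ) ^ (i : ℕ) • LinearMap.BilinForm.comp ω (face V i) (face V i)

/-- `ω` is multiplicative if `δ ω = 0`. -/
def IsMultiplicative (V : SimplicialVS.{u}) {q : ℕ} (ω : LinearMap.BilinForm ℝ (V _⦋q⦌)) : Prop :=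
  coboundary V ω = 0

/-- `ω` is normalized if its pullbacks along all degeneracies vanish. -/
def IsNormalized (V : SimplicialVS.{u}) {q : ℕ} (ω : LinearMap.BilinForm ℝ (V _⦋q + 1⦌)) : Prop :=
  ∀ i : Fin (q + 1), LinearMap.BilinForm.comp ω (degen V i) (degen V i) = 0

/-- The sum of the degenerate subspaces of `V_{q+1}`. -/
def degenerate (V : SimplicialVS.{u}) (q : ℕ) : Submodule ℝ (V _⦋q + 1⦌) :=
  ⨆ i : Fin (q + 1), LinearMap.range (degen V i)

/-- The normalized tangent space in degree `q + 1`.  (The tangent space of a vector space at each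
of its points is the vector space itself.)  In degree `0` the normalized tangent space is `V_0`. -/
abbrev NormalizedTangent (V : SimplicialVS.{u}) (q : ℕ) : Type u :=
  V _⦋q + 1⦌ ⧸ degenerate V q

/-- The map `σ_0 σ_0 : V_0 → V_2`. -/
def unitMap (V : SimplicialVS.{u}) : V _⦋0⦌ →ₗ[ℝ] V _⦋2⦌ :=
  degen V (q := 1) 0 ∘ₗ degen V (q := 0) 0

/-- `Ã_ω (v, w) = ω (σ_0 σ_0 v, w)`, for `v ∈ V_0` and `w ∈ V_2`. -/
def preA (V : SimplicialVS.{u}) (ω : LinearMap.BilinForm ℝ (V _⦋2⦌)) :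
    V _⦋0⦌ →ₗ[ℝ] V _⦋2⦌ →ₗ[ℝ] ℝ :=
  ω ∘ₗ unitMap V

/-- `B̃_ω (θ, η) = ω (σ_1 θ, σ_0 η) + ω (σ_1 η, σ_0 θ)`, for `θ, η ∈ V_1`. -/
def preB (V : SimplicialVS.{u}) (ω : LinearMap.BilinForm ℝ (V _⦋2⦌)) :
    V _⦋1⦌ →ₗ[ℝ] V _⦋1⦌ →ₗ[ℝ] ℝ :=
  ω.compl₁₂ (degen V (q := 1) 1) (degen V (q := 1) 0)
    + (ω.compl₁₂ (degen V (q := 1) 1) (degen V (q := 1) 0)).flip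

theorem degen_degen (V : SimplicialVS.{u}) (v : V _⦋0⦌) :
    degen V (q := 1) 1 (degen V (q := 0) 0 v) = degen V (q := 1) 0 (degen V (q := 0) 0 v) := by
  have h := V.σ_comp_σ (n := 0) (i := 0) (j := 0) le_rfl
  have h' := congrArg (fun f => f.hom v) h
  exact h'.symm

theorem IsNormalized.apply {V : SimplicialVS.{u}} {ω : LinearMap.BilinForm ℝ (V _⦋2⦌)}
    (h : IsNormalized V (q := 1) ω) (i : Fin 2) (x y : V _⦋1⦌) :
    ω (degen V (q := 1) i x) (degen V (q := 1) i y) = 0 :=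
  congrArg (fun b : LinearMap.BilinForm ℝ (V _⦋1⦌) => b x y) (h i)

theorem preA_degenerate {V : SimplicialVS.{u}} {ω : LinearMap.BilinForm ℝ (V _⦋2⦌)}
    (h : IsNormalized V (q := 1) ω) : degenerate V 1 ≤ LinearMap.ker (preA V ω).flip := by
  refine iSup_le fun i => ?_
  rintro _ ⟨y, rfl⟩
  rw [LinearMap.mem_ker]
  ext v
  change ω (degen V (q := 1) 0 (degen V (q := 0) 0 v)) (degen V (q := 1) i y) = 0
  fin_cases i
  · exact h.apply 0 _ _
  · rw [← degen_degen]
    exact h.apply 1 _ _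

theorem preB_degenerate {V : SimplicialVS.{u}} {ω : LinearMap.BilinForm ℝ (V _⦋2⦌)}
    (h : IsNormalized V (q := 1) ω) : degenerate V 0 ≤ LinearMap.ker (preB V ω) := by
  refine iSup_le fun i => ?_
  rintro _ ⟨v, rfl⟩
  rw [LinearMap.mem_ker]
  ext η
  fin_cases i
  change ω (degen V (q := 1) 1 (degen V (q := 0) 0 v)) (degen V (q := 1) 0 η)
    + ω (degen V (q := 1) 1 η) (degen V (q := 1) 0 (degen V (q := 0) 0 v)) = 0
  rw [← degen_degen, h.apply 1, degen_degen, h.apply 0, add_zero]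

theorem preB_flip {V : SimplicialVS.{u}} (ω : LinearMap.BilinForm ℝ (V _⦋2⦌)) :
    (preB V ω).flip = preB V ω := by
  ext x y
  exact add_comm _ _

/-- The pairing `A_ω` between `V_0` and the normalized tangent space in degree `2`. -/
def pairingA (V : SimplicialVS.{u}) (ω : LinearMap.BilinForm ℝ (V _⦋2⦌))
    (h : IsNormalized V (q := 1) ω) : V _⦋0⦌ →ₗ[ℝ] NormalizedTangent V 1 →ₗ[ℝ] ℝ :=
  ((degenerate V 1).liftQ (preA V ω).flip (preA_degenerate h)).flip

/-- The form `B_ω` on the normalized tangent space in degree `1`. -/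
def pairingB (V : SimplicialVS.{u}) (ω : LinearMap.BilinForm ℝ (V _⦋2⦌))
    (h : IsNormalized V (q := 1) ω) :
    NormalizedTangent V 0 →ₗ[ℝ] NormalizedTangent V 0 →ₗ[ℝ] ℝ :=
  (degenerate V 0).liftQ
    ((degenerate V 0).liftQ (preB V ω) (preB_degenerate h)).flip
    (by
      intro x hx
      rw [LinearMap.mem_ker]
      ext y
      have hx' := preB_degenerate h hx
      rw [LinearMap.mem_ker, ← preB_flip] at hx'
      exact congrArg (fun f : V _⦋1⦌ →ₗ[ℝ] ℝ => f y) hx')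

theorem pairingA_mk (V : SimplicialVS.{u}) (ω : LinearMap.BilinForm ℝ (V _⦋2⦌))
    (h : IsNormalized V (q := 1) ω) (v : V _⦋0⦌) (w : V _⦋2⦌) :
    pairingA V ω h v (Submodule.Quotient.mk w)
      = ω (degen V (q := 1) 0 (degen V (q := 0) 0 v)) w := rfl

theorem pairingB_mk (V : SimplicialVS.{u}) (ω : LinearMap.BilinForm ℝ (V _⦋2⦌))
    (h : IsNormalized V (q := 1) ω) (θ η : V _⦋1⦌) :
    pairingB V ω h (Submodule.Quotient.mk θ) (Submodule.Quotient.mk η)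
      = ω (degen V (q := 1) 1 θ) (degen V (q := 1) 0 η)
        + ω (degen V (q := 1) 1 η) (degen V (q := 1) 0 θ) :=
  add_comm _ _

/-! ### Constant symplectic 2-groupoids -/

/-- A constant symplectic 2-groupoid: a linear 2-groupoid with a constant (hence closed)
multiplicative, normalized and simplicially nondegenerate 2-form on `V_2`. -/
structure ConstSymp2Groupoid : Type (u + 1) where
  V : SimplicialVS.{u}
  isLinearGroupoid : IsLinearGroupoid 2 V
  ω : LinearMap.BilinForm ℝ (V _⦋2⦌)
  isAlt : ω.IsAlt
  isMultiplicative : IsMultiplicative V (q := 2) ω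
  isNormalized : IsNormalized V (q := 1) ω
  nondegenerate_A : (pairingA V ω isNormalized).Nondegenerate
  nondegenerate_B : (pairingB V ω isNormalized).Nondegenerate

/-- An isomorphism of constant symplectic 2-groupoids: an isomorphism of simplicial vector spaces
that preserves the 2-forms. -/
@[ext]
structure SympIso (X Y : ConstSymp2Groupoid.{u}) where
  iso : X.V ≅ Y.V
  map_ω : ∀ x y : X.V _⦋2⦌,
    Y.ω ((iso.hom.app (op ⦋2⦌)).hom x) ((iso.hom.app (op ⦋2⦌)).hom y) = X.ω x y

/-- The component in degree `q` of an isomorphism. -/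
abbrev SympIso.app {X Y : ConstSymp2Groupoid.{u}} (f : SympIso X Y) (q : ℕ) :
    X.V _⦋q⦌ →ₗ[ℝ] Y.V _⦋q⦌ :=
  (f.iso.hom.app (op ⦋q⦌)).hom

/-- Constant symplectic 2-groupoids up to isomorphism. -/
def sympSetoid : Setoid ConstSymp2Groupoid.{u} where
  r X Y := Nonempty (SympIso X Y)
  iseqv :=
    { refl := fun X => ⟨⟨Iso.refl _, fun _ _ => rfl⟩⟩
      symm := by
        rintro X Y ⟨f⟩
        refine ⟨⟨f.iso.symm, fun x y => ?_⟩⟩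
        have key : ∀ z : Y.V _⦋2⦌,
            (f.iso.hom.app (op ⦋2⦌)).hom ((f.iso.inv.app (op ⦋2⦌)).hom z) = z := fun z =>
          congrArg (fun g => g.hom z) (f.iso.inv_hom_id_app (op ⦋2⦌))
        have := f.map_ω ((f.iso.inv.app (op ⦋2⦌)).hom x) ((f.iso.inv.app (op ⦋2⦌)).hom y)
        rw [key, key] at this
        exact this.symm
      trans := by
        rintro X Y Z ⟨f⟩ ⟨g⟩
        exact ⟨⟨f.iso ≪≫ g.iso, fun x y => (g.map_ω _ _).trans (f.map_ω x y)⟩⟩ }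

/-! ### The associated 3-term complex and the forms `C₄₁`, `C₃₂` -/

/-- `W_0 = V_0`. -/
abbrev cplx0 (V : SimplicialVS.{u}) : Type u := V _⦋0⦌

/-- `W_1 = ker f_0 ⊆ V_1`. -/
def cplx1 (V : SimplicialVS.{u}) : Submodule ℝ (V _⦋1⦌) :=
  LinearMap.ker (face V (q := 0) 0)

/-- `W_2`, the kernel of the horn map `(f_0, f_1)` on `V_2`. -/
def cplx2 (V : SimplicialVS.{u}) : Submodule ℝ (V _⦋2⦌) :=
  LinearMap.ker (face V (q := 1) 0) ⊓ LinearMap.ker (face V (q := 1) 1)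

/-- `∂_1 = - f_1 : W_1 → W_0`. -/
def bdry1 (V : SimplicialVS.{u}) : cplx1 V →ₗ[ℝ] cplx0 V :=
  -(face V (q := 0) 1 ∘ₗ (cplx1 V).subtype)

theorem face_two_mem (V : SimplicialVS.{u}) (w : cplx2 V) : face V (q := 1) 2 w.1 ∈ cplx1 V := by
  have h := V.δ_comp_δ (n := 0) (i := 0) (j := 1) (by decide)
  have h' : face V (q := 0) 0 (face V (q := 1) 2 w.1)
      = face V (q := 0) 1 (face V (q := 1) 0 w.1) := congrArg (fun f => f.hom w.1) h
  have h0 : face V (q := 1) 0 w.1 = 0 := w.2.1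
  change face V (q := 0) 0 (face V (q := 1) 2 w.1) = 0
  rw [h', h0, map_zero]

/-- `∂_2 = f_2 : W_2 → W_1`. -/
def bdry2 (V : SimplicialVS.{u}) : cplx2 V →ₗ[ℝ] cplx1 V :=
  (face V (q := 1) 2 ∘ₗ (cplx2 V).subtype).codRestrict (cplx1 V) (face_two_mem V)

/-- The identification of `W_2 ⊕ W_1 ⊕ W_1 ⊕ W_0` with `V_2`: with `v = w_1 + σ_0 w_0` and
`v' = w_1' + σ_0 w_0` in `V_1`, it sends `(w_2, w_1, w_1', w_0)` to
`w_2 + σ_0 v + σ_1 (v' - v)`. -/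
def assemble (V : SimplicialVS.{u}) (w₂ : cplx2 V) (w₁ w₁' : cplx1 V) (w₀ : cplx0 V) : V _⦋2⦌ :=
  (w₂ : V _⦋2⦌)
    + degen V (q := 1) 0 ((w₁ : V _⦋1⦌) + degen V (q := 0) 0 w₀)
    + degen V (q := 1) 1 (((w₁' : V _⦋1⦌) + degen V (q := 0) 0 w₀)
        - ((w₁ : V _⦋1⦌) + degen V (q := 0) 0 w₀))

/-- The component `C₄₁` of `ω`, a pairing of `W_0` with `W_2`. -/
def C41 (X : ConstSymp2Groupoid.{u}) (w₀ : cplx0 X.V) (w₂ : cplx2 X.V) : ℝ :=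
  X.ω (assemble X.V 0 0 0 w₀) (assemble X.V w₂ 0 0 0)

/-- The component `C₃₂` of `ω`, a bilinear form on `W_1`. -/
def C32 (X : ConstSymp2Groupoid.{u}) (w w' : cplx1 X.V) : ℝ :=
  X.ω (assemble X.V 0 0 w 0) (assemble X.V 0 w' 0 0)

/-- The map induced on `W_1` by an isomorphism. -/
def SympIso.app1 {X Y : ConstSymp2Groupoid.{u}} (f : SympIso X Y) : cplx1 X.V →ₗ[ℝ] cplx1 Y.V :=
  (f.app 1 ∘ₗ (cplx1 X.V).subtype).codRestrict (cplx1 Y.V) (by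
    intro w
    have h := SimplicialObject.δ_naturality f.iso.hom (n := 0) 0
    have h' : f.app 0 (face X.V (q := 0) 0 w.1) = face Y.V (q := 0) 0 (f.app 1 w.1) :=
      congrArg (fun g => g.hom w.1) h
    have h0 : face X.V (q := 0) 0 w.1 = 0 := w.2
    change face Y.V (q := 0) 0 (f.app 1 w.1) = 0
    rw [← h', h0, map_zero])

/-! ### The linear algebra data -/

/-- The map `∂^* : W_0^* → W_1^* ≅ W_1`, where the identification is made by the form `b`. -/
noncomputable def adjointMap {W₁ W₀ : Type u} [AddCommGroup W₁] [Module ℝ W₁]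
    [FiniteDimensional ℝ W₁] [AddCommGroup W₀] [Module ℝ W₀] (b : LinearMap.BilinForm ℝ W₁)
    (hb : b.Nondegenerate) (d : W₁ →ₗ[ℝ] W₀) : Module.Dual ℝ W₀ →ₗ[ℝ] W₁ :=
  (b.toDual hb).symm.toLinearMap ∘ₗ d.dualMap

/-- Tuples `(W_1, W_0, ⟨·,·⟩, ∂, r)`. Elements of `∧² W_1^*` are alternating bilinear forms. -/
structure LinearData : Type (u + 1) where
  W₁ : Type u
  W₀ : Type u
  [addCommGroup₁ : AddCommGroup W₁]
  [module₁ : Module ℝ W₁]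
  [finiteDimensional₁ : FiniteDimensional ℝ W₁]
  [addCommGroup₀ : AddCommGroup W₀]
  [module₀ : Module ℝ W₀]
  [finiteDimensional₀ : FiniteDimensional ℝ W₀]
  form : LinearMap.BilinForm ℝ W₁
  form_symm : form.IsSymm
  form_nondegenerate : form.Nondegenerate
  bdry : W₁ →ₗ[ℝ] W₀
  isotropic : ∀ x ∈ LinearMap.range (adjointMap form form_nondegenerate bdry),
    ∀ y ∈ LinearMap.range (adjointMap form form_nondegenerate bdry), form x y = 0
  r : LinearMap.BilinForm ℝ W₁
  r_isAlt : r.IsAlt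

attribute [instance] LinearData.addCommGroup₁ LinearData.module₁ LinearData.finiteDimensional₁
  LinearData.addCommGroup₀ LinearData.module₀ LinearData.finiteDimensional₀

/-- The map `∂^* : W_0^* → W_1` of a tuple. -/
noncomputable def LinearData.bdryStar (T : LinearData.{u}) : Module.Dual ℝ T.W₀ →ₗ[ℝ] T.W₁ :=
  adjointMap T.form T.form_nondegenerate T.bdry

/-- An isomorphism of tuples. -/
@[ext]
structure DataIso (S T : LinearData.{u}) where
  e₁ : S.W₁ ≃ₗ[ℝ] T.W₁
  e₀ : S.W₀ ≃ₗ[ℝ] T.W₀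
  map_form : ∀ x y, T.form (e₁ x) (e₁ y) = S.form x y
  map_bdry : ∀ x, T.bdry (e₁ x) = e₀ (S.bdry x)
  map_r : ∀ x y, T.r (e₁ x) (e₁ y) = S.r x y

/-- Tuples up to isomorphism. -/
def dataSetoid : Setoid LinearData.{u} where
  r S T := Nonempty (DataIso S T)
  iseqv :=
    { refl := fun S =>
        ⟨⟨LinearEquiv.refl ℝ _, LinearEquiv.refl ℝ _, fun _ _ => rfl, fun _ => rfl, fun _ _ => rfl⟩⟩
      symm := by
        rintro S T ⟨f⟩
        refine ⟨⟨f.e₁.symm, f.e₀.symm, fun x y => ?_, fun x => ?_, fun x y => ?_⟩⟩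
        · rw [← f.map_form]; simp
        · rw [LinearEquiv.eq_symm_apply, ← f.map_bdry]; simp
        · rw [← f.map_r]; simp
      trans := by
        rintro S T U ⟨f⟩ ⟨g⟩
        refine ⟨⟨f.e₁.trans g.e₁, f.e₀.trans g.e₀, fun x y => ?_, fun x => ?_, fun x y => ?_⟩⟩
        · exact (g.map_form _ _).trans (f.map_form _ _)
        · change U.bdry (g.e₁ (f.e₁ x)) = g.e₀ (f.e₀ (S.bdry x))
          rw [g.map_bdry, f.map_bdry]
        · exact (g.map_r _ _).trans (f.map_r _ _) }

/-! ### The correspondence -/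

/-- The way in which a constant symplectic 2-groupoid `X` corresponds to a tuple `T`: an
isomorphism of the 3-term complex of `X` with `W_0^* → W_1 → W_0` (with differentials `∂^*` and
`∂`) that carries `C₄₁` to the canonical pairing and `C₃₂` to `½ ⟨·,·⟩ + r`. -/
structure Presentation (X : ConstSymp2Groupoid.{u}) (T : LinearData.{u}) where
  e₀ : cplx0 X.V ≃ₗ[ℝ] T.W₀
  e₁ : cplx1 X.V ≃ₗ[ℝ] T.W₁
  e₂ : cplx2 X.V ≃ₗ[ℝ] Module.Dual ℝ T.W₀
  map_bdry1 : ∀ w, e₀ (bdry1 X.V w) = T.bdry (e₁ w)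
  map_bdry2 : ∀ w, e₁ (bdry2 X.V w) = T.bdryStar (e₂ w)
  map_C41 : ∀ w₀ w₂, C41 X w₀ w₂ = e₂ w₂ (e₀ w₀)
  map_C32 : ∀ w w', C32 X w w' = 1 / 2 * T.form (e₁ w) (e₁ w') + T.r (e₁ w) (e₁ w')

/-- An isomorphism `f` of constant symplectic 2-groupoids and an isomorphism `g` of tuples match
each other under the given presentations. -/
def Matches {X Y : ConstSymp2Groupoid.{u}} {S T : LinearData.{u}} (φ : Presentation X S)
    (ψ : Presentation Y T) (f : SympIso X Y) (g : DataIso S T) : Prop :=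
  (∀ x, ψ.e₀ (f.app 0 x) = g.e₀ (φ.e₀ x)) ∧ ∀ w, ψ.e₁ (f.app1 w) = g.e₁ (φ.e₁ w)

end ConstSymplectic

/-!
A labelling of a simplicial vector space by a complex `W₂ → W₁ → W₀` assigns labels in `Wₖ` to the
`k`-simplices, so that they vanish on degenerate simplices and the differentials compute the
boundaries.  The labellings of the standard simplices form a linear 2-groupoid, the nerve of the
complex, and every linear 2-groupoid is, by its own labelling, the nerve of its associated complex
(Dold–Kan).

Evaluating multiplicativity on degenerate 3-simplices expresses all components of a normalized form
`ω` through `C₄₁` and `C₃₂`, and shows that the symmetrization of `C₃₂` makes `∂₂` adjoint to `∂₁`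
once `W₂` is identified with `W₀^*` by `C₄₁`.  The antisymmetric part of `C₃₂` is unconstrained: it
is `r`.  Conversely the form with given `C₄₁` and `C₃₂` can be written down explicitly in terms of
the labels.  The image of `∂^*` is isotropic exactly when `∂ ∘ ∂^* = 0`.
-/

namespace ConstSymplectic

/-! ### Simplicial identities on elements -/

section Identities

variable (V : SimplicialVS.{u}) {q : ℕ}

theorem face_face_of_le {i j : Fin (q + 2)} (h : i ≤ j) (x : V _⦋q + 2⦌) :
    face V i (face V j.succ x) = face V j (face V i.castSucc x) :=
  congrArg (fun f => f.hom x) (V.δ_comp_δ h)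

theorem face_degen_of_le {i : Fin (q + 2)} {j : Fin (q + 1)} (h : i ≤ j.castSucc)
    (x : V _⦋q + 1⦌) : face V i.castSucc (degen V j.succ x) = degen V j (face V i x) :=
  congrArg (fun f => f.hom x) (V.δ_comp_σ_of_le h)

theorem face_degen_of_gt {i : Fin (q + 2)} {j : Fin (q + 1)} (h : j.castSucc < i)
    (x : V _⦋q + 1⦌) : face V i.succ (degen V j.castSucc x) = degen V j (face V i x) :=
  congrArg (fun f => f.hom x) (V.δ_comp_σ_of_gt h)

theorem face_degen_self (i : Fin (q + 1)) (x : V _⦋q⦌) : face V i.castSucc (degen V i x) = x :=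
  congrArg (fun f => f.hom x) V.δ_comp_σ_self

theorem face_degen_succ (i : Fin (q + 1)) (x : V _⦋q⦌) : face V i.succ (degen V i x) = x :=
  congrArg (fun f => f.hom x) V.δ_comp_σ_succ

theorem face_zero_face_one (x : V _⦋q + 2⦌) : face V 0 (face V 1 x) = face V 0 (face V 0 x) :=
  face_face_of_le V (j := 0) le_rfl x

theorem face_zero_face_two (x : V _⦋q + 2⦌) : face V 0 (face V 2 x) = face V 1 (face V 0 x) :=
  face_face_of_le V (j := 1) (Fin.zero_le _) x

theorem face_one_face_two (x : V _⦋q + 2⦌) : face V 1 (face V 2 x) = face V 1 (face V 1 x) :=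
  face_face_of_le V (i := 1) le_rfl x

theorem face_zero_face_three (x : V _⦋q + 3⦌) : face V 0 (face V 3 x) = face V 2 (face V 0 x) :=
  face_face_of_le V (j := 2) (Fin.zero_le _) x

theorem face_one_face_three (x : V _⦋q + 3⦌) : face V 1 (face V 3 x) = face V 2 (face V 1 x) :=
  face_face_of_le V (i := 1) (j := Fin.succ 1) (Fin.succ_le_succ_iff.2 (Fin.zero_le _)) x

theorem face_two_face_three (x : V _⦋q + 3⦌) : face V 2 (face V 3 x) = face V 2 (face V 2 x) :=
  face_face_of_le V (i := 2) le_rfl x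

theorem face_zero_degen_zero (x : V _⦋q⦌) : face V 0 (degen V 0 x) = x :=
  face_degen_self V 0 x

theorem face_one_degen_zero (x : V _⦋q⦌) : face V 1 (degen V 0 x) = x :=
  face_degen_succ V 0 x

theorem face_two_degen_zero (x : V _⦋q + 1⦌) :
    face V 2 (degen V 0 x) = degen V 0 (face V 1 x) :=
  face_degen_of_gt V (i := 1) (j := 0) Fin.castSucc_lt_succ x

theorem face_zero_degen_one (x : V _⦋q + 1⦌) :
    face V 0 (degen V 1 x) = degen V 0 (face V 0 x) :=
  face_degen_of_le V (j := 0) le_rfl x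

theorem face_one_degen_one (x : V _⦋q + 1⦌) : face V 1 (degen V 1 x) = x :=
  face_degen_self V 1 x

theorem face_two_degen_one (x : V _⦋q + 1⦌) : face V 2 (degen V 1 x) = x :=
  face_degen_succ V 1 x

theorem face_three_degen_zero (x : V _⦋q + 2⦌) :
    face V 3 (degen V 0 x) = degen V 0 (face V 2 x) :=
  face_degen_of_gt V (i := Fin.succ 1) (j := 0) (Fin.castSucc_lt_succ_iff.2 (Fin.zero_le _)) x

theorem face_three_degen_one (x : V _⦋q + 2⦌) :
    face V 3 (degen V 1 x) = degen V 1 (face V 2 x) :=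
  face_degen_of_gt V (i := Fin.succ 1) (j := 1) Fin.castSucc_lt_succ x

theorem face_zero_degen_two (x : V _⦋q + 2⦌) :
    face V 0 (degen V 2 x) = degen V 1 (face V 0 x) :=
  face_degen_of_le V (j := 1) (Fin.zero_le _) x

theorem face_one_degen_two (x : V _⦋q + 2⦌) :
    face V 1 (degen V 2 x) = degen V 1 (face V 1 x) :=
  face_degen_of_le V (i := 1) (j := 1) le_rfl x

theorem face_two_degen_two (x : V _⦋q + 2⦌) : face V 2 (degen V 2 x) = x :=
  face_degen_self V 2 x

theorem face_three_degen_two (x : V _⦋q + 2⦌) : face V 3 (degen V 2 x) = x :=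
  face_degen_succ V 2 x

end Identities

/-! ### Horn filling -/

/-- The horn map `λ_{q + 1, k}`, which forgets the `k`-th face. -/
def hornMap (V : SimplicialVS.{u}) {q : ℕ} (k : Fin (q + 2)) :
    V _⦋q + 1⦌ →ₗ[ℝ] {i : Fin (q + 2) // i ≠ k} → V _⦋q⦌ :=
  LinearMap.pi fun i => face V i.1

section Horns

variable {V : SimplicialVS.{u}} {q : ℕ} {k : Fin (q + 2)}
  {x y : {i : Fin (q + 2) // i ≠ k} → V _⦋q⦌}

theorem degen_mem_degenerate (i : Fin (q + 1)) (x : V _⦋q⦌) : degen V i x ∈ degenerate V q :=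
  Submodule.mem_iSup_of_mem i ⟨x, rfl⟩

theorem isHorn_hornMap (k : Fin (q + 2)) (z : V _⦋q + 1⦌) : IsHorn V q k (hornMap V k z) := by
  cases q with
  | zero => trivial
  | succ q => exact fun i j _ _ hij => face_face_of_le V hij z

theorem IsHorn.sub (hx : IsHorn V q k x) (hy : IsHorn V q k y) : IsHorn V q k (x - y) := by
  cases q with
  | zero => trivial
  | succ q =>
    intro i j hi hj hij
    rw [Pi.sub_apply, Pi.sub_apply, map_sub, map_sub, hx i j hi hj hij, hy i j hi hj hij]

theorem IsHorn.face_degen_eq_zero (hx : IsHorn V q k x) {a b : {i : Fin (q + 2) // i ≠ k}}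
    {j : Fin (q + 1)} (hb : b.1 = j.castSucc ∨ b.1 = j.succ) (hl : a.1 ≠ j.castSucc)
    (hr : a.1 ≠ j.succ) (ha : x a = 0) : face V a.1 (degen V j (x b)) = 0 := by
  obtain ⟨a, hak⟩ := a
  obtain ⟨b, hbk⟩ := b
  dsimp only at hb hl hr ⊢
  cases q with
  | zero => omega
  | succ q =>
    rcases hl.lt_or_gt with haj | haj
    · obtain ⟨a, rfl⟩ := Fin.exists_castSucc_eq.2 (Fin.ne_last_of_lt haj)
      obtain ⟨j, rfl⟩ := Fin.exists_succ_eq.2 (show j ≠ 0 by grind)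
      obtain ⟨b, rfl⟩ := Fin.exists_succ_eq.2 (show b ≠ 0 by grind)
      have hab : a ≤ b := by grind
      rw [face_degen_of_le V (by grind), hx a b hak hbk hab, ha, map_zero, map_zero]
    · obtain ⟨a, rfl⟩ := Fin.exists_succ_eq.2 (Fin.ne_zero_of_lt haj)
      obtain ⟨j, rfl⟩ := Fin.exists_castSucc_eq.2 (show j ≠ Fin.last _ by grind)
      obtain ⟨b, rfl⟩ := Fin.exists_castSucc_eq.2 (show b ≠ Fin.last _ by grind)
      have hab : b ≤ a := by grind
      rw [face_degen_of_gt V (by grind), ← hx b a hbk hak hab, ha, map_zero, map_zero]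

theorem IsHorn.sub_hornMap_degen_eq_zero (hx : IsHorn V q k x) {a b : {i : Fin (q + 2) // i ≠ k}}
    {j : Fin (q + 1)} (hb : b.1 = j.castSucc ∨ b.1 = j.succ)
    (ha : a = b ∨ (a.1 ≠ j.castSucc ∧ a.1 ≠ j.succ) ∧ x a = 0) :
    (x - hornMap V k (degen V j (x b))) a = 0 := by
  change x a - face V a.1 (degen V j (x b)) = 0
  rcases ha with rfl | ⟨⟨hl, hr⟩, ha⟩
  · rcases hb with hb | hb
    · rw [hb, face_degen_self, sub_self]
    · rw [hb, face_degen_succ, sub_self]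
  · rw [ha, hx.face_degen_eq_zero hb hl hr ha, sub_zero]

theorem mem_map_hornMap_of_sub {d : V _⦋q + 1⦌} (hd : d ∈ degenerate V q)
    (h : x - hornMap V k d ∈ (degenerate V q).map (hornMap V k)) :
    x ∈ (degenerate V q).map (hornMap V k) :=
  (Submodule.sub_mem_iff_left _ (Submodule.mem_map_of_mem hd)).1 h

/-- The nonzero entries are removed one by one, from the outside towards the missing one. -/
theorem IsHorn.mem_map_degenerate_of_eq_zero (n : ℕ) :
    ∀ {x : {i : Fin (q + 2) // i ≠ k} → V _⦋q⦌} {l r : ℕ}, IsHorn V q k x → l ≤ k → k ≤ r →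
      r < q + 2 → r ≤ l + n → (∀ a, (a.1 : ℕ) < l ∨ r < (a.1 : ℕ) → x a = 0) →
        x ∈ (degenerate V q).map (hornMap V k) := by
  induction n with
  | zero =>
    intro x l r _ hl hr _ hlr hz
    have hx0 : x = 0 := funext fun a => hz a (by grind)
    exact hx0 ▸ zero_mem _
  | succ n ih =>
    intro x l r hx hl hr hr' hlr hz
    have hsub (d) : IsHorn V q k (x - hornMap V k d) := hx.sub (isHorn_hornMap k d)
    by_cases hlk : l < k
    · let j : Fin (q + 1) := ⟨l, by omega⟩
      have hj : j.castSucc ≠ k := by grind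
      refine mem_map_hornMap_of_sub (degen_mem_degenerate j (x ⟨j.castSucc, hj⟩))
        (ih (l := l + 1) (hsub _) hlk hr hr' (by omega) fun a ha =>
          hx.sub_hornMap_degen_eq_zero (Or.inl rfl) ?_)
      by_cases haj : a.1 = j.castSucc
      · exact Or.inl (Subtype.ext haj)
      · exact Or.inr ⟨⟨haj, by grind⟩, hz a (by grind)⟩
    by_cases hkr : k < r
    · let j : Fin (q + 1) := ⟨r - 1, by omega⟩
      have hj : j.succ ≠ k := by grind
      refine mem_map_hornMap_of_sub (degen_mem_degenerate j (x ⟨j.succ, hj⟩))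
        (ih (r := r - 1) (hsub _) hl (by omega) (by omega) (by omega) fun a ha =>
          hx.sub_hornMap_degen_eq_zero (Or.inr rfl) ?_)
      by_cases haj : a.1 = j.succ
      · exact Or.inl (Subtype.ext haj)
      · exact Or.inr ⟨⟨by grind, haj⟩, hz a (by grind)⟩
    exact ih hx hl hr hr' (by omega) hz

theorem IsHorn.exists_mem_degenerate (hx : IsHorn V q k x) :
    ∃ d ∈ degenerate V q, hornMap V k d = x :=
  hx.mem_map_degenerate_of_eq_zero (q + 1) (l := 0) (r := q + 1) (Nat.zero_le _) (by omega)
    (by omega) (by omega) (by grind)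

theorem isLinearGroupoid_of_injective {n : ℕ} (hfin : ∀ q : ℕ, FiniteDimensional ℝ (V _⦋q⦌))
    (hV : ∀ q : ℕ, n < q + 1 → ∀ k : Fin (q + 2), Function.Injective (hornMap V k)) :
    IsLinearGroupoid n V where
  finiteDimensional := hfin
  horn_surjective q k x hx := by
    obtain ⟨d, -, hd⟩ := hx.exists_mem_degenerate
    exact ⟨d, congrFun hd⟩
  horn_bijective q hq k x hx := by
    obtain ⟨d, -, hd⟩ := hx.exists_mem_degenerate
    exact ⟨d, congrFun hd, fun z hz => hV q hq k ((funext hz).trans hd.symm)⟩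

theorem IsLinearGroupoid.hornMap_injective {n : ℕ} (hV : IsLinearGroupoid n V) (hq : n < q + 1)
    (k : Fin (q + 2)) : Function.Injective (hornMap V k) := fun _ z h =>
  (hV.horn_bijective q hq k _ (isHorn_hornMap k z)).unique (congrFun h) fun _ => rfl

theorem IsLinearGroupoid.degenerate_eq_top {n : ℕ} (hV : IsLinearGroupoid n V) (hq : n < q + 1) :
    degenerate V q = ⊤ := by
  refine eq_top_iff.2 fun z _ => ?_
  obtain ⟨d, hd, hdz⟩ := (isHorn_hornMap 0 z).exists_mem_degenerate
  rwa [← hV.hornMap_injective hq 0 hdz]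

end Horns

section AlternatingSum

variable {V : SimplicialVS.{u}} {q : ℕ}

theorem face_degen_mem_degenerate {i : Fin (q + 2)} {j : Fin (q + 3)} (hl : j ≠ i.castSucc)
    (hr : j ≠ i.succ) (x : V _⦋q + 1⦌) : face V j (degen V i x) ∈ degenerate V q := by
  rcases hl.lt_or_gt with hji | hji
  · obtain ⟨j, rfl⟩ := Fin.exists_castSucc_eq.2 (Fin.ne_last_of_lt hji)
    obtain ⟨i, rfl⟩ := Fin.exists_succ_eq.2 (show i ≠ 0 by grind)
    rw [face_degen_of_le V (by grind)]
    exact degen_mem_degenerate i _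
  · obtain ⟨j, rfl⟩ := Fin.exists_succ_eq.2 (Fin.ne_zero_of_lt hji)
    obtain ⟨i, rfl⟩ := Fin.exists_castSucc_eq.2 (show i ≠ Fin.last _ by grind)
    rw [face_degen_of_gt V (by grind)]
    exact degen_mem_degenerate i _

theorem sum_face_degen_mem_degenerate (i : Fin (q + 2)) (x : V _⦋q + 1⦌) :
    ∑ j : Fin (q + 3), (-1 : ℝ) ^ (j : ℕ) • face V j (degen V i x) ∈ degenerate V q := by
  rw [Fin.sum_univ_succAbove _ i.castSucc, Fin.sum_univ_succAbove _ i, ← add_assoc,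
    Fin.succAbove_castSucc_self, face_degen_self, face_degen_succ, Fin.val_castSucc, Fin.val_succ,
    pow_succ, mul_neg_one, neg_smul, add_neg_cancel, zero_add]
  refine sum_mem fun j _ => Submodule.smul_mem _ _ (face_degen_mem_degenerate ?_ ?_ x)
  · exact Fin.succAbove_ne _ _
  · rw [← Fin.succAbove_castSucc_self]
    exact fun h => Fin.succAbove_ne i j (Fin.succAbove_right_injective h)

theorem degenerate_le_comap_sum_face :
    degenerate V (q + 1) ≤
      (degenerate V q).comap (∑ j : Fin (q + 3), (-1 : ℝ) ^ (j : ℕ) • face V j) := by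
  refine iSup_le fun i => ?_
  rintro _ ⟨y, rfl⟩
  simpa only [Submodule.mem_comap, LinearMap.sum_apply, LinearMap.smul_apply] using
    sum_face_degen_mem_degenerate i y

end AlternatingSum

/-! ### The projections onto the associated complex -/

section Projections

variable (V : SimplicialVS.{u})

/-- The projection of `V_1` onto `W_1` along `σ_0 V_0`. -/
def proj1 : V _⦋1⦌ →ₗ[ℝ] cplx1 V :=
  (LinearMap.id - degen V (q := 0) 0 ∘ₗ face V (q := 0) 0).codRestrict (cplx1 V) fun x => by
    change face V (q := 0) 0 (x - degen V (q := 0) 0 (face V (q := 0) 0 x)) = 0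
    rw [map_sub, face_zero_degen_zero, sub_self]

/-- The projection of `V_2` onto `W_2` along `σ_0 V_1 + σ_1 V_1`. -/
def proj2 : V _⦋2⦌ →ₗ[ℝ] cplx2 V :=
  (LinearMap.id - degen V (q := 1) 0 ∘ₗ face V (q := 1) 0
    - degen V (q := 1) 1 ∘ₗ (face V (q := 1) 1 - face V (q := 1) 0)).codRestrict (cplx2 V)
  fun x => by
    set y := x - degen V (q := 1) 0 (face V (q := 1) 0 x)
      - degen V (q := 1) 1 (face V (q := 1) 1 x - face V (q := 1) 0 x)
    change face V (q := 1) 0 y = 0 ∧ face V (q := 1) 1 y = 0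
    simp only [y, map_sub, face_zero_degen_zero, face_zero_degen_one, face_zero_face_one,
      face_one_degen_zero, face_one_degen_one, sub_self, and_self]

variable {V}

theorem face_zero_cplx1 (w : cplx1 V) : face V (q := 0) 0 w = 0 := w.2

theorem face_zero_cplx2 (w : cplx2 V) : face V (q := 1) 0 w = 0 := w.2.1

theorem face_one_cplx2 (w : cplx2 V) : face V (q := 1) 1 w = 0 := w.2.2

theorem face_two_cplx2 (w : cplx2 V) : face V (q := 1) 2 w = bdry2 V w := rfl

theorem face_one_cplx1 (u : cplx1 V) : face V (q := 0) 1 u = -bdry1 V u := (neg_neg _).symm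

theorem bdry1_bdry2 (w : cplx2 V) : bdry1 V (bdry2 V w) = 0 := by
  rw [bdry1, LinearMap.neg_apply, LinearMap.comp_apply, Submodule.subtype_apply, ← face_two_cplx2,
    face_one_face_two, face_one_cplx2, map_zero, neg_zero]

theorem coe_proj1 (x : V _⦋1⦌) :
    (proj1 V x : V _⦋1⦌) = x - degen V (q := 0) 0 (face V (q := 0) 0 x) := rfl

theorem coe_proj2 (x : V _⦋2⦌) :
    (proj2 V x : V _⦋2⦌) = x - degen V (q := 1) 0 (face V (q := 1) 0 x)
      - degen V (q := 1) 1 (face V (q := 1) 1 x - face V (q := 1) 0 x) := rfl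

theorem proj1_coe (w : cplx1 V) : proj1 V w = w := by
  ext
  rw [coe_proj1, face_zero_cplx1, map_zero, sub_zero]

theorem proj2_coe (w : cplx2 V) : proj2 V w = w := by
  ext
  simp only [coe_proj2, face_zero_cplx2, face_one_cplx2, map_zero, sub_zero]

theorem proj1_degen (v : V _⦋0⦌) : proj1 V (degen V (q := 0) 0 v) = 0 := by
  ext
  rw [coe_proj1, face_zero_degen_zero, sub_self, ZeroMemClass.coe_zero]

theorem proj2_degen (i : Fin 2) (x : V _⦋1⦌) : proj2 V (degen V (q := 1) i x) = 0 := by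
  ext
  rw [coe_proj2]
  match i with
  | 0 => simp only [face_zero_degen_zero, face_one_degen_zero, sub_self, map_zero,
      ZeroMemClass.coe_zero]
  | 1 => simp only [face_zero_degen_one, face_one_degen_one, map_sub, degen_degen, sub_self,
      ZeroMemClass.coe_zero]

theorem ker_proj1 : LinearMap.ker (proj1 V) = degenerate V 0 := by
  apply le_antisymm
  · intro x hx
    have h : x = degen V (q := 0) 0 (face V (q := 0) 0 x) := by
      rw [← sub_eq_zero, ← coe_proj1, LinearMap.mem_ker.1 hx, ZeroMemClass.coe_zero]
    exact h ▸ degen_mem_degenerate _ _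
  · refine iSup_le fun i => ?_
    rintro _ ⟨v, rfl⟩
    match i with
    | 0 => exact proj1_degen v

theorem ker_proj2 : LinearMap.ker (proj2 V) = degenerate V 1 := by
  apply le_antisymm
  · intro x hx
    have h : x = degen V (q := 1) 0 (face V (q := 1) 0 x)
        + degen V (q := 1) 1 (face V (q := 1) 1 x - face V (q := 1) 0 x) := by
      rw [← sub_eq_zero, ← sub_sub, ← coe_proj2, LinearMap.mem_ker.1 hx, ZeroMemClass.coe_zero]
    exact h ▸ add_mem (degen_mem_degenerate _ _) (degen_mem_degenerate _ _)
  · refine iSup_le fun i => ?_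
    rintro _ ⟨x, rfl⟩
    exact proj2_degen i x

theorem isCompl_cplx1_degenerate : IsCompl (cplx1 V) (degenerate V 0) :=
  ker_proj1 (V := V) ▸ LinearMap.isCompl_of_proj proj1_coe

theorem isCompl_cplx2_degenerate : IsCompl (cplx2 V) (degenerate V 1) :=
  ker_proj2 (V := V) ▸ LinearMap.isCompl_of_proj proj2_coe

theorem bdry1_proj1 (x : V _⦋1⦌) :
    bdry1 V (proj1 V x) = face V (q := 0) 0 x - face V (q := 0) 1 x := by
  change -face V (q := 0) 1 (proj1 V x : V _⦋1⦌) = _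
  rw [coe_proj1, map_sub, face_one_degen_zero, neg_sub]

theorem bdry2_proj2 (x : V _⦋2⦌) : bdry2 V (proj2 V x)
    = proj1 V (face V (q := 1) 2 x) + proj1 V (face V (q := 1) 0 x)
      - proj1 V (face V (q := 1) 1 x) := by
  ext
  change face V (q := 1) 2 (proj2 V x : V _⦋2⦌)
    = (proj1 V (face V (q := 1) 2 x) : V _⦋1⦌) + proj1 V (face V (q := 1) 0 x)
      - proj1 V (face V (q := 1) 1 x)
  simp only [coe_proj2, coe_proj1, map_sub, face_two_degen_zero, face_two_degen_one,
    face_zero_face_two, face_zero_face_one]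
  abel

theorem IsLinearGroupoid.proj2_cocycle (hV : IsLinearGroupoid 2 V) (x : V _⦋3⦌) :
    proj2 V (face V (q := 2) 0 x) - proj2 V (face V (q := 2) 1 x)
      + proj2 V (face V (q := 2) 2 x) - proj2 V (face V (q := 2) 3 x) = 0 := by
  have hx : x ∈ degenerate V 2 := hV.degenerate_eq_top (Nat.lt_succ_self 2) ▸ Submodule.mem_top
  have h := degenerate_le_comap_sum_face hx
  rw [← ker_proj2, Submodule.mem_comap, LinearMap.mem_ker, Fin.sum_univ_four] at h
  simpa [sub_eq_add_neg, pow_succ] using h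

end Projections

/-! ### Maps of simplicial vector spaces -/

section Maps

variable {V V' : SimplicialVS.{u}}

/-- The component in degree `q` of a map of simplicial vector spaces. -/
abbrev appLin (f : V ⟶ V') (q : ℕ) : V _⦋q⦌ →ₗ[ℝ] V' _⦋q⦌ :=
  (f.app (op ⦋q⦌)).hom

variable {q : ℕ} (f : V ⟶ V') {g : V ⟶ V'}

theorem face_appLin (i : Fin (q + 2)) (x : V _⦋q + 1⦌) :
    face V' i (appLin f (q + 1) x) = appLin f q (face V i x) :=
  (congrArg (fun g => g.hom x) (SimplicialObject.δ_naturality f i)).symm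

theorem degen_appLin (i : Fin (q + 1)) (x : V _⦋q⦌) :
    degen V' i (appLin f q x) = appLin f (q + 1) (degen V i x) :=
  (congrArg (fun g => g.hom x) (SimplicialObject.σ_naturality f i)).symm

/-- The map induced on `W_1`. -/
def cplx1Map : cplx1 V →ₗ[ℝ] cplx1 V' :=
  (appLin f 1 ∘ₗ (cplx1 V).subtype).codRestrict (cplx1 V') fun w => by
    change face V' (q := 0) 0 (appLin f 1 w) = 0
    rw [face_appLin, face_zero_cplx1, map_zero]

/-- The map induced on `W_2`. -/
def cplx2Map : cplx2 V →ₗ[ℝ] cplx2 V' :=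
  (appLin f 2 ∘ₗ (cplx2 V).subtype).codRestrict (cplx2 V') fun w => by
    change face V' (q := 1) 0 (appLin f 2 w) = 0 ∧ face V' (q := 1) 1 (appLin f 2 w) = 0
    simp only [face_appLin, face_zero_cplx2, face_one_cplx2, map_zero, and_self]

theorem coe_cplx1Map (w : cplx1 V) : (cplx1Map f w : V' _⦋1⦌) = appLin f 1 w := rfl

theorem coe_cplx2Map (w : cplx2 V) : (cplx2Map f w : V' _⦋2⦌) = appLin f 2 w := rfl

variable {f}

theorem degenerate_le_range_appLin (hf : Function.Surjective (appLin f q)) :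
    degenerate V' q ≤ LinearMap.range (appLin f (q + 1)) := by
  refine iSup_le fun i => ?_
  rintro _ ⟨y, rfl⟩
  obtain ⟨x, rfl⟩ := hf y
  exact ⟨degen V i x, (degen_appLin f i x).symm⟩

theorem face_eq_zero_of_appLin_eq_zero (hf : Function.Injective (appLin f q)) {x : V _⦋q + 1⦌}
    (hx : appLin f (q + 1) x = 0) (i : Fin (q + 2)) : face V i x = 0 :=
  hf (by rw [← face_appLin, hx, map_zero, map_zero])

theorem bijective_appLin_one (h₀ : Function.Bijective (appLin f 0))
    (h₁ : Function.Bijective (cplx1Map f)) : Function.Bijective (appLin f 1) := by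
  constructor
  · refine (injective_iff_map_eq_zero _).2 fun x hx => ?_
    have hx0 : face V (q := 0) 0 x = 0 := face_eq_zero_of_appLin_eq_zero h₀.1 hx 0
    exact congrArg Subtype.val (h₁.1 (a₁ := ⟨x, hx0⟩) (a₂ := 0) (by
      rw [map_zero]; exact Subtype.ext hx))
  · rw [← LinearMap.range_eq_top, eq_top_iff, ← isCompl_cplx1_degenerate.sup_eq_top]
    refine sup_le (fun z hz => ?_) (degenerate_le_range_appLin h₀.2)
    obtain ⟨w, hw⟩ := h₁.2 ⟨z, hz⟩
    exact ⟨w, congrArg Subtype.val hw⟩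

theorem bijective_appLin_two (h₁ : Function.Bijective (appLin f 1))
    (h₂ : Function.Bijective (cplx2Map f)) : Function.Bijective (appLin f 2) := by
  constructor
  · refine (injective_iff_map_eq_zero _).2 fun x hx => ?_
    have hx' := face_eq_zero_of_appLin_eq_zero (q := 1) h₁.1 hx
    exact congrArg Subtype.val (h₂.1 (a₁ := ⟨x, hx' 0, hx' 1⟩) (a₂ := 0) (by
      rw [map_zero]; exact Subtype.ext hx))
  · rw [← LinearMap.range_eq_top, eq_top_iff, ← isCompl_cplx2_degenerate.sup_eq_top]
    refine sup_le (fun z hz => ?_) (degenerate_le_range_appLin h₁.2)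
    obtain ⟨w, hw⟩ := h₂.2 ⟨z, hz⟩
    exact ⟨w, congrArg Subtype.val hw⟩

theorem IsLinearGroupoid.bijective_appLin_succ {n : ℕ} (hV : IsLinearGroupoid n V)
    (hV' : IsLinearGroupoid n V') (hq : n < q + 1) (h : Function.Bijective (appLin f q)) :
    Function.Bijective (appLin f (q + 1)) := by
  constructor
  · refine (injective_iff_map_eq_zero _).2 fun x hx => hV.hornMap_injective hq 0 ?_
    rw [map_zero]
    exact funext fun i => face_eq_zero_of_appLin_eq_zero h.1 hx i.1
  · rw [← LinearMap.range_eq_top, eq_top_iff, ← hV'.degenerate_eq_top hq]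
    exact degenerate_le_range_appLin h.2

theorem IsLinearGroupoid.bijective_appLin (hV : IsLinearGroupoid 2 V) (hV' : IsLinearGroupoid 2 V')
    (h₀ : Function.Bijective (appLin f 0)) (h₁ : Function.Bijective (cplx1Map f))
    (h₂ : Function.Bijective (cplx2Map f)) (q : ℕ) : Function.Bijective (appLin f q) := by
  have h₁' := bijective_appLin_one h₀ h₁
  match q with
  | 0 => exact h₀
  | 1 => exact h₁'
  | q + 2 =>
    induction q with
    | zero => exact bijective_appLin_two h₁' h₂
    | succ q ih => exact hV.bijective_appLin_succ hV' (Nat.lt_add_left q (Nat.lt_succ_self 2)) ih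

/-- A levelwise bijective map of simplicial vector spaces, as an isomorphism. -/
noncomputable def isoOfBijective (f : V ⟶ V') (h : ∀ q, Function.Bijective (appLin f q)) :
    V ≅ V' :=
  haveI : ∀ q, IsIso (f.app q) := fun q => (ConcreteCategory.isIso_iff_bijective _).2 (h q.unop.len)
  haveI : IsIso f := NatIso.isIso_of_isIso_app f
  asIso f

theorem degenerate_le_eqLocus (h : appLin f q = appLin g q) :
    degenerate V q ≤ LinearMap.eqLocus (appLin f (q + 1)) (appLin g (q + 1)) := by
  refine iSup_le fun i => ?_
  rintro _ ⟨x, rfl⟩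
  rw [LinearMap.mem_eqLocus, ← degen_appLin, ← degen_appLin, h]

theorem IsLinearGroupoid.hom_ext (hV : IsLinearGroupoid 2 V) (h₀ : appLin f 0 = appLin g 0)
    (h₁ : cplx1Map f = cplx1Map g) (h₂ : cplx2Map f = cplx2Map g) : f = g := by
  suffices h : ∀ q, appLin f q = appLin g q from
    SimplicialObject.hom_ext f g fun q => ModuleCat.hom_ext (h q.unop.len)
  have step (q) (p : Submodule ℝ (V _⦋q + 1⦌)) (hp : p ⊔ degenerate V q = ⊤)
      (hpf : p ≤ LinearMap.eqLocus (appLin f (q + 1)) (appLin g (q + 1)))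
      (hq : appLin f q = appLin g q) : appLin f (q + 1) = appLin g (q + 1) :=
    LinearMap.eqLocus_eq_top.1 (eq_top_iff.2 (hp ▸ sup_le hpf (degenerate_le_eqLocus hq)))
  intro q
  induction q with
  | zero => exact h₀
  | succ q ih =>
    match q with
    | 0 =>
      exact step 0 _ isCompl_cplx1_degenerate.sup_eq_top
        (fun w hw => congrArg Subtype.val (LinearMap.congr_fun h₁ ⟨w, hw⟩)) ih
    | 1 =>
      exact step 1 _ isCompl_cplx2_degenerate.sup_eq_top
        (fun w hw => congrArg Subtype.val (LinearMap.congr_fun h₂ ⟨w, hw⟩)) ih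
    | q + 2 =>
      refine step _ ⊥ ?_ bot_le ih
      rw [bot_sup_eq, hV.degenerate_eq_top (by omega)]

end Maps

/-! ### Restriction along maps of simplices -/

section Restriction

variable (V : SimplicialVS.{u})

/-- The structure map `a^* : V_n → V_m` of a map of simplices `a : ⦋m⦌ ⟶ Δ`, where `n` is the
dimension of `Δ`. -/
abbrev pullback {m : ℕ} {Δ : SimplexCategory} (a : ⦋m⦌ ⟶ Δ) : V.obj (op Δ) →ₗ[ℝ] V _⦋m⦌ :=
  (V.map a.op).hom

variable {m n : ℕ} {Δ : SimplexCategory}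

theorem pullback_comp {Θ : SimplexCategory} (a : ⦋m⦌ ⟶ Δ) (b : Δ ⟶ Θ) (x : V.obj (op Θ)) :
    pullback V (a ≫ b) x = pullback V a ((V.map b.op).hom x) :=
  congrArg (fun f => f.hom x) (V.map_comp b.op a.op)

theorem face_pullback (i : Fin (m + 2)) (a : ⦋m + 1⦌ ⟶ Δ) (x : V.obj (op Δ)) :
    face V i (pullback V a x) = pullback V (SimplexCategory.δ i ≫ a) x :=
  (pullback_comp V _ _ x).symm

theorem degen_pullback (i : Fin (m + 1)) (a : ⦋m⦌ ⟶ Δ) (x : V.obj (op Δ)) :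
    degen V i (pullback V a x) = pullback V (SimplexCategory.σ i ≫ a) x :=
  (pullback_comp V _ _ x).symm

theorem pullback_id (x : V _⦋m⦌) : pullback V (𝟙 ⦋m⦌) x = x :=
  congrArg (fun f => f.hom x) (V.map_id (op ⦋m⦌))

variable {V}

theorem pullback_eq_zero {x : V _⦋n + 1⦌} (hx : ∀ i, face V i x = 0) {a : ⦋m⦌ ⟶ ⦋n + 1⦌}
    (ha : ¬Function.Surjective a.toOrderHom) : pullback V a x = 0 := by
  obtain ⟨i, b, rfl⟩ := SimplexCategory.eq_comp_δ_of_not_surjective a ha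
  have hi : (V.map (SimplexCategory.δ i).op).hom x = 0 := hx i
  rw [pullback_comp, hi, map_zero]

theorem pullback_mem_degenerate {a : ⦋m + 1⦌ ⟶ Δ} (ha : ¬Function.Injective a.toOrderHom)
    (x : V.obj (op Δ)) : pullback V a x ∈ degenerate V m := by
  obtain ⟨i, b, rfl⟩ := SimplexCategory.eq_σ_comp_of_not_injective a ha
  rw [← degen_pullback]
  exact degen_mem_degenerate i _

theorem pullback_mem_degenerate_of_face_eq_zero {x : V _⦋n + 1⦌} (hx : ∀ i, face V i x = 0)
    {a : ⦋m + 1⦌ ⟶ ⦋n + 1⦌} (ha : ¬Function.Bijective a.toOrderHom) :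
    pullback V a x ∈ degenerate V m := by
  by_cases hinj : Function.Injective a.toOrderHom
  · exact pullback_eq_zero hx (fun hsurj => ha ⟨hinj, hsurj⟩) ▸ zero_mem _
  · exact pullback_mem_degenerate hinj x

theorem eq_id_of_bijective {a : ⦋m⦌ ⟶ ⦋m⦌} (ha : Function.Bijective a.toOrderHom) : a = 𝟙 _ :=
  haveI := SimplexCategory.isIso_of_bijective ha
  SimplexCategory.eq_id_of_isIso a

theorem not_bijective_of_ne (hmn : m ≠ n) (a : ⦋m⦌ ⟶ ⦋n⦌) :
    ¬Function.Bijective a.toOrderHom := fun h => hmn <| by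
  simpa using Fintype.card_congr (Equiv.ofBijective _ h)

theorem face_face_eq_zero {k : Fin (n + 3)} {x : V _⦋n + 2⦌} (hx : ∀ i ≠ k, face V i x = 0)
    (j : Fin (n + 2)) : face V j (face V k x) = 0 := by
  rcases le_or_gt k j.castSucc with hkj | hjk
  · obtain ⟨k, rfl⟩ := Fin.exists_castSucc_eq.2 (show k ≠ Fin.last _ by grind)
    rw [← face_face_of_le V (by grind), hx _ (by grind), map_zero]
  · obtain ⟨k, rfl⟩ := Fin.exists_succ_eq.2 (show k ≠ 0 by grind)
    rw [face_face_of_le V (by grind), hx _ (by grind), map_zero]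

end Restriction

/-! ### Labellings by a complex and the nerve of a complex -/

section Labellings

variable {W₀ W₁ W₂ : Type u} [AddCommGroup W₀] [Module ℝ W₀] [AddCommGroup W₁] [Module ℝ W₁]
  [AddCommGroup W₂] [Module ℝ W₂]

/-- A labelling of a simplicial vector space by the complex `d₂`, `d₁`: linear labels of the
vertices by `W₀`, of the edges by `W₁` and of the triangles by `W₂`, zero on degenerate simplices
and compatible with the differentials. -/
structure Labelling (V : SimplicialVS.{u}) (d₁ : W₁ →ₗ[ℝ] W₀) (d₂ : W₂ →ₗ[ℝ] W₁) where
  vert : V _⦋0⦌ →ₗ[ℝ] W₀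
  edge : V _⦋1⦌ →ₗ[ℝ] W₁
  tri : V _⦋2⦌ →ₗ[ℝ] W₂
  edge_degen (x : V _⦋0⦌) : edge (degen V (q := 0) 0 x) = 0
  tri_degen (i : Fin 2) (x : V _⦋1⦌) : tri (degen V (q := 1) i x) = 0
  bdry_edge (x : V _⦋1⦌) :
    d₁ (edge x) = vert (face V (q := 0) 0 x) - vert (face V (q := 0) 1 x)
  bdry_tri (x : V _⦋2⦌) : d₂ (tri x)
    = edge (face V (q := 1) 2 x) + edge (face V (q := 1) 0 x) - edge (face V (q := 1) 1 x)
  cocycle (x : V _⦋3⦌) : tri (face V (q := 2) 0 x) - tri (face V (q := 2) 1 x)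
    + tri (face V (q := 2) 2 x) - tri (face V (q := 2) 3 x) = 0

variable {V : SimplicialVS.{u}} {d₁ : W₁ →ₗ[ℝ] W₀} {d₂ : W₂ →ₗ[ℝ] W₁}

theorem Labelling.edge_eq_zero (L : Labelling V d₁ d₂) {x : V _⦋1⦌} (hx : x ∈ degenerate V 0) :
    L.edge x = 0 := by
  have h : degenerate V 0 ≤ LinearMap.ker L.edge := iSup_le fun i => by
    rintro _ ⟨y, rfl⟩
    match i with
    | 0 => exact L.edge_degen y
  exact h hx

theorem Labelling.tri_eq_zero (L : Labelling V d₁ d₂) {x : V _⦋2⦌} (hx : x ∈ degenerate V 1) :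
    L.tri x = 0 := by
  have h : degenerate V 1 ≤ LinearMap.ker L.tri := iSup_le fun i => by
    rintro _ ⟨y, rfl⟩
    exact L.tri_degen i y
  exact h hx

theorem Labelling.vert_bdry1 (L : Labelling V d₁ d₂) (w : cplx1 V) :
    L.vert (bdry1 V w) = d₁ (L.edge w) := by
  have h := L.bdry_edge w
  rw [face_zero_cplx1, map_zero, zero_sub, ← map_neg] at h
  exact h.symm

theorem Labelling.edge_bdry2 (L : Labelling V d₁ d₂) (w : cplx2 V) :
    L.edge (bdry2 V w) = d₂ (L.tri w) := by
  have h := L.bdry_tri w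
  rw [face_zero_cplx2, face_one_cplx2, map_zero, add_zero, sub_zero] at h
  exact h.symm

/-- The labelling given by a map from the associated complex of a linear 2-groupoid. -/
def Labelling.ofComplexMap (hV : IsLinearGroupoid 2 V) (e₀ : cplx0 V →ₗ[ℝ] W₀)
    (e₁ : cplx1 V →ₗ[ℝ] W₁) (e₂ : cplx2 V →ₗ[ℝ] W₂) (h₁ : ∀ w, e₀ (bdry1 V w) = d₁ (e₁ w))
    (h₂ : ∀ w, e₁ (bdry2 V w) = d₂ (e₂ w)) : Labelling V d₁ d₂ where
  vert := e₀
  edge := e₁ ∘ₗ proj1 V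
  tri := e₂ ∘ₗ proj2 V
  edge_degen x := by rw [LinearMap.comp_apply, proj1_degen, map_zero]
  tri_degen i x := by rw [LinearMap.comp_apply, proj2_degen, map_zero]
  bdry_edge x := by rw [LinearMap.comp_apply, ← h₁, bdry1_proj1, map_sub]
  bdry_tri x := by
    simp only [LinearMap.comp_apply, ← h₂, bdry2_proj2, map_sub, map_add]
  cocycle x := by
    simpa only [LinearMap.comp_apply, map_add, map_sub, map_zero]
      using congrArg e₂ (hV.proj2_cocycle x)

variable (d₁ d₂) in
/-- The labellings of the maps from the standard simplices of dimension `0`, `1`, `2` to `Δ`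
which satisfy the conditions of a `Labelling`. -/
structure IsSimplexLabelling {Δ : SimplexCategory}
    (x : ((⦋0⦌ ⟶ Δ) → W₀) × ((⦋1⦌ ⟶ Δ) → W₁) × ((⦋2⦌ ⟶ Δ) → W₂)) : Prop where
  edge_degen (a : ⦋0⦌ ⟶ Δ) : x.2.1 (SimplexCategory.σ 0 ≫ a) = 0
  tri_degen (i : Fin 2) (a : ⦋1⦌ ⟶ Δ) : x.2.2 (SimplexCategory.σ i ≫ a) = 0
  bdry_edge (a : ⦋1⦌ ⟶ Δ) :
    d₁ (x.2.1 a) = x.1 (SimplexCategory.δ 0 ≫ a) - x.1 (SimplexCategory.δ 1 ≫ a)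
  bdry_tri (a : ⦋2⦌ ⟶ Δ) : d₂ (x.2.2 a) = x.2.1 (SimplexCategory.δ 2 ≫ a)
    + x.2.1 (SimplexCategory.δ 0 ≫ a) - x.2.1 (SimplexCategory.δ 1 ≫ a)
  cocycle (a : ⦋3⦌ ⟶ Δ) : x.2.2 (SimplexCategory.δ 0 ≫ a) - x.2.2 (SimplexCategory.δ 1 ≫ a)
    + x.2.2 (SimplexCategory.δ 2 ≫ a) - x.2.2 (SimplexCategory.δ 3 ≫ a) = 0

variable (d₁ d₂) in
/-- The vector space of labellings of the simplex `Δ`. -/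
def simplexLabellings (Δ : SimplexCategory) :
    Submodule ℝ (((⦋0⦌ ⟶ Δ) → W₀) × ((⦋1⦌ ⟶ Δ) → W₁) × ((⦋2⦌ ⟶ Δ) → W₂)) where
  carrier := {x | IsSimplexLabelling d₁ d₂ x}
  zero_mem' := by constructor <;> simp
  add_mem' {x y} hx hy :=
    { edge_degen := fun a => by simp [hx.edge_degen, hy.edge_degen]
      tri_degen := fun i a => by simp [hx.tri_degen, hy.tri_degen]
      bdry_edge := fun a => by
        linear_combination (norm := (simp; module)) hx.bdry_edge a + hy.bdry_edge a
      bdry_tri := fun a => by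
        linear_combination (norm := (simp; module)) hx.bdry_tri a + hy.bdry_tri a
      cocycle := fun a => by
        linear_combination (norm := (simp; module)) hx.cocycle a + hy.cocycle a }
  smul_mem' c x hx :=
    { edge_degen := fun a => by simp [hx.edge_degen]
      tri_degen := fun i a => by simp [hx.tri_degen]
      bdry_edge := fun a => by
        linear_combination (norm := (simp; module)) c • hx.bdry_edge a
      bdry_tri := fun a => by
        linear_combination (norm := (simp; module)) c • hx.bdry_tri a
      cocycle := fun a => by
        linear_combination (norm := (simp; module)) c • hx.cocycle a }

variable (d₁ d₂) in
/-- The nerve of the complex `d₂`, `d₁`: its `n`-simplices are the labellings of the standard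
`n`-simplex.  Maps of simplicial vector spaces to it are labellings. -/
def nerve : SimplicialVS.{u} where
  obj Δ := ModuleCat.of ℝ (simplexLabellings d₁ d₂ Δ.unop)
  map f := ModuleCat.ofHom <| LinearMap.restrict
    ((LinearMap.funLeft ℝ W₀ (· ≫ f.unop)).prodMap
      ((LinearMap.funLeft ℝ W₁ (· ≫ f.unop)).prodMap (LinearMap.funLeft ℝ W₂ (· ≫ f.unop))))
    fun _ hx =>
      { edge_degen := fun a => hx.edge_degen (a ≫ f.unop)
        tri_degen := fun i a => hx.tri_degen i (a ≫ f.unop)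
        bdry_edge := fun a => hx.bdry_edge (a ≫ f.unop)
        bdry_tri := fun a => hx.bdry_tri (a ≫ f.unop)
        cocycle := fun a => hx.cocycle (a ≫ f.unop) }

variable (d₁ d₂) in
/-- The labelling of the nerve by the labels of the identity maps of the simplices. -/
def nerveLabelling : Labelling (nerve d₁ d₂) d₁ d₂ where
  vert := LinearMap.proj (𝟙 _) ∘ₗ LinearMap.fst ℝ _ _ ∘ₗ (simplexLabellings d₁ d₂ ⦋0⦌).subtype
  edge := LinearMap.proj (𝟙 _) ∘ₗ LinearMap.fst ℝ _ _ ∘ₗ LinearMap.snd ℝ _ _ ∘ₗ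
    (simplexLabellings d₁ d₂ ⦋1⦌).subtype
  tri := LinearMap.proj (𝟙 _) ∘ₗ LinearMap.snd ℝ _ _ ∘ₗ LinearMap.snd ℝ _ _ ∘ₗ
    (simplexLabellings d₁ d₂ ⦋2⦌).subtype
  edge_degen x := x.2.edge_degen (𝟙 _)
  tri_degen i x := x.2.tri_degen i (𝟙 _)
  bdry_edge x := x.2.bdry_edge (𝟙 _)
  bdry_tri x := x.2.bdry_tri (𝟙 _)
  cocycle x := x.2.cocycle (𝟙 _)

theorem vert_pullback {Δ : SimplexCategory} (x : (nerve d₁ d₂).obj (op Δ)) (a : ⦋0⦌ ⟶ Δ) :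
    (nerveLabelling d₁ d₂).vert (pullback _ a x) = x.1.1 a :=
  congrArg x.1.1 (Category.id_comp a)

theorem edge_pullback {Δ : SimplexCategory} (x : (nerve d₁ d₂).obj (op Δ)) (a : ⦋1⦌ ⟶ Δ) :
    (nerveLabelling d₁ d₂).edge (pullback _ a x) = x.1.2.1 a :=
  congrArg x.1.2.1 (Category.id_comp a)

theorem tri_pullback {Δ : SimplexCategory} (x : (nerve d₁ d₂).obj (op Δ)) (a : ⦋2⦌ ⟶ Δ) :
    (nerveLabelling d₁ d₂).tri (pullback _ a x) = x.1.2.2 a :=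
  congrArg x.1.2.2 (Category.id_comp a)

theorem eq_zero_of_labels_eq_zero {n : ℕ} {x : nerve d₁ d₂ _⦋n⦌}
    (h₀ : ∀ a : ⦋0⦌ ⟶ ⦋n⦌, (nerveLabelling d₁ d₂).vert (pullback _ a x) = 0)
    (h₁ : ∀ a : ⦋1⦌ ⟶ ⦋n⦌, (nerveLabelling d₁ d₂).edge (pullback _ a x) = 0)
    (h₂ : ∀ a : ⦋2⦌ ⟶ ⦋n⦌, (nerveLabelling d₁ d₂).tri (pullback _ a x) = 0) : x = 0 :=
  Subtype.ext (Prod.ext (funext fun a => (vert_pullback x a).symm.trans (h₀ a))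
    (Prod.ext (funext fun a => (edge_pullback x a).symm.trans (h₁ a))
      (funext fun a => (tri_pullback x a).symm.trans (h₂ a))))

theorem Labelling.isSimplexLabelling (L : Labelling V d₁ d₂) {Δ : SimplexCategory}
    (x : V.obj (op Δ)) : IsSimplexLabelling d₁ d₂
      (fun a => L.vert (pullback V a x), fun a => L.edge (pullback V a x),
        fun a => L.tri (pullback V a x)) where
  edge_degen a := by simpa only [degen_pullback] using L.edge_degen (pullback V a x)
  tri_degen i a := by simpa only [degen_pullback] using L.tri_degen i (pullback V a x)
  bdry_edge a := by simpa only [face_pullback] using L.bdry_edge (pullback V a x)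
  bdry_tri a := by simpa only [face_pullback] using L.bdry_tri (pullback V a x)
  cocycle a := by simpa only [face_pullback] using L.cocycle (pullback V a x)

/-- The map to the nerve given by a labelling. -/
def Labelling.toNerve (L : Labelling V d₁ d₂) : V ⟶ nerve d₁ d₂ where
  app Δ := ModuleCat.ofHom <| LinearMap.codRestrict (simplexLabellings d₁ d₂ Δ.unop)
    ((LinearMap.pi fun a => L.vert ∘ₗ pullback V a).prod
      ((LinearMap.pi fun a => L.edge ∘ₗ pullback V a).prod
        (LinearMap.pi fun a => L.tri ∘ₗ pullback V a)))
    L.isSimplexLabelling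
  naturality Δ Θ f := by
    refine ModuleCat.hom_ext (LinearMap.ext fun x => Subtype.ext (Prod.ext ?_ (Prod.ext ?_ ?_)))
    · exact funext fun a => congrArg L.vert (pullback_comp V a f.unop x).symm
    · exact funext fun a => congrArg L.edge (pullback_comp V a f.unop x).symm
    · exact funext fun a => congrArg L.tri (pullback_comp V a f.unop x).symm

theorem Labelling.vert_toNerve (L : Labelling V d₁ d₂) (x : V _⦋0⦌) :
    (nerveLabelling d₁ d₂).vert (appLin L.toNerve 0 x) = L.vert x :=
  congrArg L.vert (pullback_id V x)

theorem Labelling.edge_toNerve (L : Labelling V d₁ d₂) (x : V _⦋1⦌) :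
    (nerveLabelling d₁ d₂).edge (appLin L.toNerve 1 x) = L.edge x :=
  congrArg L.edge (pullback_id V x)

theorem Labelling.tri_toNerve (L : Labelling V d₁ d₂) (x : V _⦋2⦌) :
    (nerveLabelling d₁ d₂).tri (appLin L.toNerve 2 x) = L.tri x :=
  congrArg L.tri (pullback_id V x)

end Labellings

/-! ### The nerve as a linear 2-groupoid -/

section Nerve

variable {W₀ W₁ W₂ : Type u} [AddCommGroup W₀] [Module ℝ W₀] [AddCommGroup W₁] [Module ℝ W₁]
  [AddCommGroup W₂] [Module ℝ W₂] {d₁ : W₁ →ₗ[ℝ] W₀} {d₂ : W₂ →ₗ[ℝ] W₁}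

theorem nerve_eq_zero {n : ℕ} {x : nerve d₁ d₂ _⦋n + 1⦌} (hx : ∀ i, face _ i x = 0)
    (h₁ : ∀ a : ⦋1⦌ ⟶ ⦋n + 1⦌, Function.Bijective a.toOrderHom →
      (nerveLabelling d₁ d₂).edge (pullback _ a x) = 0)
    (h₂ : ∀ a : ⦋2⦌ ⟶ ⦋n + 1⦌, Function.Bijective a.toOrderHom →
      (nerveLabelling d₁ d₂).tri (pullback _ a x) = 0) : x = 0 := by
  refine eq_zero_of_labels_eq_zero (fun a => ?_) (fun a => ?_) fun a => ?_
  · have ha : ¬Function.Surjective a.toOrderHom := fun h => by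
      simpa using Fintype.card_le_of_surjective _ h
    rw [pullback_eq_zero hx ha, map_zero]
  · by_cases ha : Function.Bijective a.toOrderHom
    · exact h₁ a ha
    · exact (nerveLabelling d₁ d₂).edge_eq_zero (pullback_mem_degenerate_of_face_eq_zero hx ha)
  · by_cases ha : Function.Bijective a.toOrderHom
    · exact h₂ a ha
    · exact (nerveLabelling d₁ d₂).tri_eq_zero (pullback_mem_degenerate_of_face_eq_zero hx ha)

theorem nerve_zero_eq_zero {x : nerve d₁ d₂ _⦋0⦌} (hx : (nerveLabelling d₁ d₂).vert x = 0) :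
    x = 0 := by
  have hinj {m : ℕ} (a : ⦋m + 1⦌ ⟶ ⦋0⦌) : ¬Function.Injective a.toOrderHom := fun h => by
    simpa using Fintype.card_le_of_injective _ h
  refine eq_zero_of_labels_eq_zero (fun a => ?_)
    (fun a => (nerveLabelling d₁ d₂).edge_eq_zero (pullback_mem_degenerate (hinj a) x))
    fun a => (nerveLabelling d₁ d₂).tri_eq_zero (pullback_mem_degenerate (hinj a) x)
  have ha : a = 𝟙 _ := Subsingleton.elim _ _
  rw [ha, pullback_id, hx]

theorem nerve_one_eq_zero {x : nerve d₁ d₂ _⦋1⦌} (hx : ∀ i, face (q := 0) _ i x = 0)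
    (hedge : (nerveLabelling d₁ d₂).edge x = 0) : x = 0 := by
  refine nerve_eq_zero (n := 0) hx (fun a ha => ?_)
    fun a ha => (not_bijective_of_ne (by decide) a ha).elim
  rw [eq_id_of_bijective ha, pullback_id, hedge]

theorem nerve_two_eq_zero {x : nerve d₁ d₂ _⦋2⦌} (hx : ∀ i, face (q := 1) _ i x = 0)
    (htri : (nerveLabelling d₁ d₂).tri x = 0) : x = 0 := by
  refine nerve_eq_zero (n := 1) hx (fun a ha => (not_bijective_of_ne (by decide) a ha).elim)
    fun a ha => ?_
  rw [eq_id_of_bijective ha, pullback_id, htri]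

theorem nerve_eq_zero_of_three_le {n : ℕ} (hn : 2 < n + 1) {x : nerve d₁ d₂ _⦋n + 1⦌}
    (hx : ∀ i, face _ i x = 0) : x = 0 :=
  nerve_eq_zero hx (fun a ha => (not_bijective_of_ne (by omega) a ha).elim)
    fun a ha => (not_bijective_of_ne (by omega) a ha).elim

theorem hornMap_nerve_injective {n : ℕ} (hn : 2 < n + 1) (k : Fin (n + 2)) :
    Function.Injective (hornMap (nerve d₁ d₂) k) := by
  refine (injective_iff_map_eq_zero _).2 fun x hx => nerve_eq_zero_of_three_le hn fun i => ?_
  have hx' (i) (hi : i ≠ k) : face _ i x = 0 := congrFun hx ⟨i, hi⟩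
  obtain rfl | hi := eq_or_ne i k
  swap
  · exact hx' i hi
  match n with
  | 2 =>
    refine nerve_two_eq_zero (face_face_eq_zero hx') ?_
    have hc := (nerveLabelling d₁ d₂).cocycle x
    fin_cases i <;> simpa [hx'] using hc
  | n + 3 => exact nerve_eq_zero_of_three_le (by omega) (face_face_eq_zero (n := n + 2) hx')

theorem isLinearGroupoid_nerve [FiniteDimensional ℝ W₀] [FiniteDimensional ℝ W₁]
    [FiniteDimensional ℝ W₂] : IsLinearGroupoid 2 (nerve d₁ d₂) :=
  isLinearGroupoid_of_injective
    (fun q => inferInstanceAs (FiniteDimensional ℝ (simplexLabellings d₁ d₂ ⦋q⦌)))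
    fun _ => hornMap_nerve_injective

/-- The vertex `a(i)` as a real number. -/
def vertexValue {m n : ℕ} (a : ⦋m⦌ ⟶ ⦋n⦌) (i : Fin (m + 1)) : ℝ :=
  ((a.toOrderHom i : ℕ) : ℝ)

theorem vertexValue_δ {m n : ℕ} (i : Fin (m + 2)) (a : ⦋m + 1⦌ ⟶ ⦋n⦌) (j : Fin (m + 1)) :
    vertexValue (SimplexCategory.δ i ≫ a) j = vertexValue a (i.succAbove j) := rfl

theorem vertexValue_σ {m n : ℕ} (i : Fin (m + 1)) (a : ⦋m⦌ ⟶ ⦋n⦌) (j : Fin (m + 2)) :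
    vertexValue (SimplexCategory.σ i ≫ a) j = vertexValue a (i.predAbove j) := rfl

theorem vertexValue_face {m : ℕ} (i : Fin (m + 2)) (j : Fin (m + 1)) :
    vertexValue (SimplexCategory.δ i) j = (i.succAbove j : ℕ) := rfl

theorem vertexValue_id {m : ℕ} (i : Fin (m + 1)) : vertexValue (𝟙 ⦋m⦌) i = (i : ℕ) := rfl

theorem vert_bijective : Function.Bijective (nerveLabelling d₁ d₂).vert := by
  refine ⟨(injective_iff_map_eq_zero _).2 fun _ => nerve_zero_eq_zero, fun w => ?_⟩
  refine ⟨⟨(fun _ => w, 0, 0), ?_⟩, rfl⟩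
  constructor <;> intros <;> simp

variable (d₁) in
theorem isSimplexLabelling_edge {n : ℕ} (w : W₁) :
    IsSimplexLabelling (Δ := ⦋n⦌) d₁ d₂ (fun a => (vertexValue a 0 - 1) • d₁ w,
      fun a => (vertexValue a 1 - vertexValue a 0) • w, 0) where
  edge_degen a := by simp [vertexValue_σ]
  tri_degen i a := rfl
  bdry_edge a := by
    simp only [map_smul, vertexValue_δ, Fin.succAbove, Fin.castSucc_zero, lt_self_iff_false,
      ↓reduceIte, Fin.succ_zero_eq_one, zero_lt_one, Fin.isValue, Nat.reduceAdd]
    module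
  bdry_tri a := by
    simp only [Pi.zero_apply, map_zero, vertexValue_δ, Fin.succAbove, Fin.castSucc_one,
      Fin.reduceLT, ↓reduceIte, Fin.castSucc_zero, not_lt_zero, Fin.succ_one_eq_two,
      lt_self_iff_false, Fin.succ_zero_eq_one, zero_lt_one, Fin.isValue, Nat.reduceAdd]
    module
  cocycle a := by simp

-- The edge from `i` to `j` is labelled so as to vanish for `j = 2`, hence the standard 2-simplex
-- gets zero labels on its faces `0` and `1`.
theorem isSimplexLabelling_tri {n : ℕ} (hd : ∀ w, d₁ (d₂ w) = 0) (w : W₂) :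
    IsSimplexLabelling (Δ := ⦋n⦌) d₁ d₂ (0,
      fun a => ((vertexValue a 1 - vertexValue a 0) * (2 - vertexValue a 1)) • d₂ w,
      fun a => ((vertexValue a 1 - vertexValue a 0) * (vertexValue a 2 - vertexValue a 1)) • w)
    where
  edge_degen a := by simp [vertexValue_σ]
  tri_degen i a := by fin_cases i <;> simp [vertexValue_σ, Fin.predAbove]
  bdry_edge a := by simp [hd]
  bdry_tri a := by
    simp only [map_smul, vertexValue_δ, Fin.succAbove, Fin.castSucc_one, Fin.reduceLT,
      ↓reduceIte, Fin.castSucc_zero, not_lt_zero, Fin.succ_one_eq_two, lt_self_iff_false,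
      Fin.succ_zero_eq_one, zero_lt_one, Fin.isValue, Nat.reduceAdd]
    module
  cocycle a := by
    simp only [vertexValue_δ, Fin.succAbove, Fin.castSucc_one, not_lt_zero, ↓reduceIte,
      Fin.succ_one_eq_two, Fin.castSucc_zero, lt_self_iff_false, Fin.succ_zero_eq_one,
      Fin.reduceCastSucc, Fin.reduceSucc, zero_lt_one, Fin.lt_one_iff, Fin.reduceEq,
      Fin.reduceLT, Fin.isValue, Nat.reduceAdd]
    module

theorem edge_bijective :
    Function.Bijective ((nerveLabelling d₁ d₂).edge ∘ₗ (cplx1 (nerve d₁ d₂)).subtype) := by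
  constructor
  · refine (injective_iff_map_eq_zero _).2 fun x (hx : (nerveLabelling d₁ d₂).edge x = 0) => ?_
    have hbdry : bdry1 _ x = 0 := nerve_zero_eq_zero <| by rw [Labelling.vert_bdry1, hx, map_zero]
    refine Subtype.ext (nerve_one_eq_zero (fun i => ?_) hx)
    fin_cases i
    exacts [face_zero_cplx1 x, neg_eq_zero.1 hbdry]
  · intro w
    let y : nerve d₁ d₂ _⦋1⦌ := ⟨_, isSimplexLabelling_edge d₁ w⟩
    have hy : face (q := 0) _ 0 y = 0 :=
      nerve_zero_eq_zero <| (vert_pullback y (SimplexCategory.δ 0)).trans <| by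
        simp [y, vertexValue_face]
    refine ⟨⟨y, hy⟩, ?_⟩
    change (vertexValue (𝟙 _) 1 - vertexValue (𝟙 _) 0) • w = w
    simp [vertexValue_id]

theorem tri_bijective (hd : ∀ w, d₁ (d₂ w) = 0) :
    Function.Bijective ((nerveLabelling d₁ d₂).tri ∘ₗ (cplx2 (nerve d₁ d₂)).subtype) := by
  constructor
  · refine (injective_iff_map_eq_zero _).2 fun x (hx : (nerveLabelling d₁ d₂).tri x = 0) => ?_
    have hbdry : bdry2 _ x = 0 := edge_bijective.1 <| by
      rw [map_zero, LinearMap.comp_apply, Submodule.subtype_apply, Labelling.edge_bdry2, hx,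
        map_zero]
    refine Subtype.ext (nerve_two_eq_zero (fun i => ?_) hx)
    fin_cases i
    exacts [face_zero_cplx2 x, face_one_cplx2 x, congrArg Subtype.val hbdry]
  · intro w
    let y : nerve d₁ d₂ _⦋2⦌ := ⟨_, isSimplexLabelling_tri hd w⟩
    have hy (i) (h : (nerveLabelling d₁ d₂).edge (face (q := 1) _ i y) = 0) :
        face (q := 1) _ i y = 0 :=
      nerve_one_eq_zero (fun j => nerve_zero_eq_zero rfl) h
    refine ⟨⟨y, hy 0 ?_, hy 1 ?_⟩, ?_⟩
    · refine (edge_pullback y (SimplexCategory.δ 0)).trans ?_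
      simp [y, vertexValue_face]
    · refine (edge_pullback y (SimplexCategory.δ 1)).trans ?_
      simp [y, vertexValue_face, Fin.succAbove]
    · change ((vertexValue (𝟙 _) 1 - vertexValue (𝟙 _) 0)
        * (vertexValue (𝟙 _) 2 - vertexValue (𝟙 _) 1)) • w = w
      norm_num [vertexValue_id]

variable (d₁ d₂) in
/-- The degree `0` part of the isomorphism of the associated complex of the nerve with the given
complex. -/
noncomputable def nerveEquiv0 : cplx0 (nerve d₁ d₂) ≃ₗ[ℝ] W₀ :=
  .ofBijective _ vert_bijective

variable (d₁ d₂) in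
/-- The degree `1` part of the isomorphism of the associated complex of the nerve with the given
complex. -/
noncomputable def nerveEquiv1 : cplx1 (nerve d₁ d₂) ≃ₗ[ℝ] W₁ :=
  .ofBijective _ edge_bijective

/-- The degree `2` part of the isomorphism of the associated complex of the nerve with the given
complex. -/
noncomputable def nerveEquiv2 (hd : ∀ w, d₁ (d₂ w) = 0) : cplx2 (nerve d₁ d₂) ≃ₗ[ℝ] W₂ :=
  .ofBijective _ (tri_bijective hd)

end Nerve

/-! ### Multiplicative normalized forms -/

section Forms

variable {V : SimplicialVS.{u}} {ω : LinearMap.BilinForm ℝ (V _⦋2⦌)}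

theorem isMultiplicative_iff : IsMultiplicative V (q := 2) ω ↔ ∀ x y : V _⦋3⦌,
    ω (face V (q := 2) 0 x) (face V (q := 2) 0 y) - ω (face V (q := 2) 1 x) (face V (q := 2) 1 y)
      + ω (face V (q := 2) 2 x) (face V (q := 2) 2 y)
      - ω (face V (q := 2) 3 x) (face V (q := 2) 3 y) = 0 := by
  simp only [IsMultiplicative, LinearMap.BilinForm.ext_iff, coboundary]
  refine forall₂_congr fun x y => ?_
  rw [Fin.sum_univ_four]
  simp [pow_succ, ← sub_eq_add_neg]

theorem IsMultiplicative.cplx2_apply_cplx2 (hm : IsMultiplicative V (q := 2) ω) (w w' : cplx2 V) :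
    ω w w' = -ω (degen V (q := 1) 0 (bdry2 V w)) (degen V (q := 1) 1 (bdry2 V w')) := by
  have h := isMultiplicative_iff.1 hm (degen V (q := 2) 0 w) (degen V (q := 2) 1 w')
  simp -index only [face_zero_degen_zero, face_one_degen_zero, face_two_degen_zero,
    face_three_degen_zero, face_zero_degen_one, face_one_degen_one, face_two_degen_one,
    face_three_degen_one, face_zero_cplx2, face_one_cplx2, face_two_cplx2, map_zero,
    LinearMap.zero_apply] at h
  linear_combination -h

theorem IsMultiplicative.cplx2_apply_degen_one (hm : IsMultiplicative V (q := 2) ω)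
    (w : cplx2 V) (u : cplx1 V) : ω w (degen V (q := 1) 1 u)
      = -ω (degen V (q := 1) 0 (bdry2 V w)) (degen V (q := 1) 1 u) := by
  have h := isMultiplicative_iff.1 hm (degen V (q := 2) 0 w)
    (degen V (q := 2) 2 (degen V (q := 1) 1 u))
  simp -index only [face_zero_degen_zero, face_one_degen_zero, face_two_degen_zero,
    face_three_degen_zero, face_zero_degen_two, face_one_degen_two, face_two_degen_two,
    face_three_degen_two, face_zero_degen_one, face_one_degen_one, face_zero_cplx1, face_one_cplx2,
    face_two_cplx2, map_zero, LinearMap.zero_apply] at h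
  linear_combination -h

theorem IsMultiplicative.cplx2_apply_degen_zero (hm : IsMultiplicative V (q := 2) ω)
    (w : cplx2 V) (u : cplx1 V) : ω w (degen V (q := 1) 0 u)
      = -ω w (degen V (q := 1) 0 (degen V (q := 0) 0 (bdry1 V u))) := by
  have h := isMultiplicative_iff.1 hm (degen V (q := 2) 2 w)
    (degen V (q := 2) 1 (degen V (q := 1) 0 u))
  simp -index only [face_zero_degen_one, face_one_degen_one, face_two_degen_one,
    face_three_degen_one, face_zero_degen_two, face_one_degen_two, face_two_degen_two,
    face_three_degen_two, face_two_degen_zero, face_one_cplx1, degen_degen, face_zero_cplx2,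
    face_one_cplx2, map_zero, map_neg, LinearMap.zero_apply] at h
  linear_combination h

theorem IsMultiplicative.cplx2_apply_degen_sub (hm : IsMultiplicative V (q := 2) ω)
    (w : cplx2 V) (u : cplx1 V) : ω w (degen V (q := 1) 0 u) - ω w (degen V (q := 1) 1 u)
      = ω (degen V (q := 1) 1 (bdry2 V w)) (degen V (q := 1) 0 u) := by
  have h := isMultiplicative_iff.1 hm (degen V (q := 2) 1 w)
    (degen V (q := 2) 2 (degen V (q := 1) 0 u))
  simp -index only [face_zero_degen_one, face_one_degen_one, face_two_degen_one,
    face_three_degen_one, face_zero_degen_two, face_one_degen_two, face_two_degen_two,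
    face_three_degen_two, face_zero_degen_zero, face_one_degen_zero, face_zero_cplx2,
    face_two_cplx2, map_zero, LinearMap.zero_apply] at h
  linear_combination h

variable (ω) in
/-- The pairing of `W_0` with `W_2` induced by `A_ω`, which is the component `C₄₁` of `ω`. -/
def unitPairing : cplx0 V →ₗ[ℝ] cplx2 V →ₗ[ℝ] ℝ :=
  (preA V ω).compl₂ (cplx2 V).subtype

variable (ω) in
/-- The bilinear form `(u, u') ↦ ω (σ_1 u, σ_0 u')` on `W_1`, which is the component `C₃₂` of a
normalized form `ω`. -/
def degenForm : LinearMap.BilinForm ℝ (cplx1 V) :=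
  ω.compl₁₂ (degen V (q := 1) 1 ∘ₗ (cplx1 V).subtype) (degen V (q := 1) 0 ∘ₗ (cplx1 V).subtype)

theorem unitPairing_apply (v : cplx0 V) (w : cplx2 V) :
    unitPairing ω v w = ω (degen V (q := 1) 0 (degen V (q := 0) 0 v)) w := rfl

theorem degenForm_apply (u u' : cplx1 V) :
    degenForm ω u u' = ω (degen V (q := 1) 1 u) (degen V (q := 1) 0 u') := rfl

section Determined

variable {M : Type*} [AddCommGroup M] [Module ℝ M]

theorem eq_zero_of_cplx1_of_degen {l : V _⦋1⦌ →ₗ[ℝ] M} (h : ∀ u : cplx1 V, l u = 0)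
    (h' : ∀ v, l (degen V (q := 0) 0 v) = 0) : l = 0 := by
  rw [← LinearMap.ker_eq_top, eq_top_iff, ← isCompl_cplx1_degenerate.sup_eq_top]
  refine sup_le (fun u hu => h ⟨u, hu⟩) (iSup_le fun i => ?_)
  rintro _ ⟨v, rfl⟩
  match i with
  | 0 => exact h' v

theorem eq_zero_of_cplx2_of_degen {l : V _⦋2⦌ →ₗ[ℝ] M} (h : ∀ w : cplx2 V, l w = 0)
    (h' : ∀ i x, l (degen V (q := 1) i x) = 0) : l = 0 := by
  rw [← LinearMap.ker_eq_top, eq_top_iff, ← isCompl_cplx2_degenerate.sup_eq_top]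
  refine sup_le (fun w hw => h ⟨w, hw⟩) (iSup_le fun i => ?_)
  rintro _ ⟨x, rfl⟩
  exact h' i x

theorem eq_zero_of_isAlt (ha : ω.IsAlt) (hw : ∀ w w' : cplx2 V, ω w w' = 0)
    (hd : ∀ (w : cplx2 V) i x, ω w (degen V (q := 1) i x) = 0)
    (hdd : ∀ i j x y, ω (degen V (q := 1) i x) (degen V (q := 1) j y) = 0) : ω = 0 :=
  eq_zero_of_cplx2_of_degen (fun w => eq_zero_of_cplx2_of_degen (hw w) (hd w)) fun i x =>
    eq_zero_of_cplx2_of_degen (fun w => by rw [← ha.neg_eq, hd, neg_zero]) fun j y => hdd i j x y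

theorem IsNormalized.degen_zero_apply_degen_one (hn : IsNormalized V (q := 1) ω)
    (h : ∀ u u' : cplx1 V, ω (degen V (q := 1) 0 u) (degen V (q := 1) 1 u') = 0) (x y : V _⦋1⦌) :
    ω (degen V (q := 1) 0 x) (degen V (q := 1) 1 y) = 0 := by
  suffices ω.compl₁₂ (degen V (q := 1) 0) (degen V (q := 1) 1) = 0 from
    LinearMap.congr_fun₂ this x y
  refine eq_zero_of_cplx1_of_degen (fun u => eq_zero_of_cplx1_of_degen (h u) fun v => ?_)
    fun v => LinearMap.ext fun y => ?_
  · rw [LinearMap.compl₁₂_apply, degen_degen, hn.apply 0]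
  · rw [LinearMap.compl₁₂_apply, ← degen_degen, hn.apply 1, LinearMap.zero_apply]

theorem IsMultiplicative.cplx2_apply_degen_eq_zero (hm : IsMultiplicative V (q := 2) ω)
    {w : cplx2 V} (h_unit : ∀ v, ω w (degen V (q := 1) 0 (degen V (q := 0) 0 v)) = 0)
    (h : ∀ u u' : cplx1 V, ω (degen V (q := 1) 0 u) (degen V (q := 1) 1 u') = 0)
    (i : Fin 2) (x : V _⦋1⦌) : ω w (degen V (q := 1) i x) = 0 := by
  suffices ω w ∘ₗ degen V (q := 1) i = 0 from LinearMap.congr_fun this x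
  refine eq_zero_of_cplx1_of_degen (fun u => ?_) fun v => ?_ <;> rw [LinearMap.comp_apply] <;>
    match i with
    | 0 => ?_
    | 1 => ?_
  · rw [hm.cplx2_apply_degen_zero, h_unit, neg_zero]
  · rw [hm.cplx2_apply_degen_one, h, neg_zero]
  · exact h_unit v
  · rw [degen_degen, h_unit]

theorem IsMultiplicative.eq_zero (hm : IsMultiplicative V (q := 2) ω)
    (hn : IsNormalized V (q := 1) ω) (ha : ω.IsAlt) (h₁ : unitPairing ω = 0)
    (h₂ : degenForm ω = 0) : ω = 0 := by
  have h_unit (w : cplx2 V) v : ω w (degen V (q := 1) 0 (degen V (q := 0) 0 v)) = 0 := by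
    rw [← ha.neg_eq, ← unitPairing_apply, h₁, LinearMap.zero_apply, LinearMap.zero_apply, neg_zero]
  have h_degen (u u' : cplx1 V) : ω (degen V (q := 1) 0 u) (degen V (q := 1) 1 u') = 0 := by
    rw [← ha.neg_eq, ← degenForm_apply, h₂, LinearMap.zero_apply, LinearMap.zero_apply, neg_zero]
  refine eq_zero_of_isAlt ha (fun w w' => ?_)
    (fun w => hm.cplx2_apply_degen_eq_zero (h_unit w) h_degen) fun i j x y => ?_
  · rw [hm.cplx2_apply_cplx2, h_degen, neg_zero]
  · match i, j with
    | 0, 0 => exact hn.apply 0 x y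
    | 1, 1 => exact hn.apply 1 x y
    | 0, 1 => exact hn.degen_zero_apply_degen_one h_degen x y
    | 1, 0 => rw [← ha.neg_eq, hn.degen_zero_apply_degen_one h_degen, neg_zero]

end Determined

theorem eq_of_unitPairing_eq_of_degenForm_eq {ω' : LinearMap.BilinForm ℝ (V _⦋2⦌)}
    (hm : IsMultiplicative V (q := 2) ω) (hm' : IsMultiplicative V (q := 2) ω')
    (hn : IsNormalized V (q := 1) ω) (hn' : IsNormalized V (q := 1) ω')
    (ha : ω.IsAlt) (ha' : ω'.IsAlt) (h₁ : unitPairing ω = unitPairing ω')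
    (h₂ : degenForm ω = degenForm ω') : ω = ω' := by
  refine sub_eq_zero.1 (IsMultiplicative.eq_zero (isMultiplicative_iff.2 fun x y => ?_)
    (fun i => ?_) (fun x => ?_) (sub_eq_zero.2 h₁) (sub_eq_zero.2 h₂))
  · simp only [LinearMap.sub_apply]
    linear_combination isMultiplicative_iff.1 hm x y - isMultiplicative_iff.1 hm' x y
  · ext x y
    exact sub_eq_zero.2 ((hn.apply i x y).trans (hn'.apply i x y).symm)
  · exact sub_eq_zero.2 ((ha.self_eq_zero x).trans (ha'.self_eq_zero x).symm)

theorem nondegenerate_pairingA_iff (hn : IsNormalized V (q := 1) ω) :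
    (pairingA V ω hn).Nondegenerate ↔ (unitPairing ω).Nondegenerate := by
  let e := Submodule.quotientEquivOfIsCompl _ _ (isCompl_cplx2_degenerate (V := V)).symm
  have h : (LinearEquiv.refl ℝ (V _⦋0⦌)).arrowCongr (e.arrowCongr (LinearEquiv.refl ℝ ℝ))
      (pairingA V ω hn) = unitPairing ω := LinearMap.ext₂ fun v w => pairingA_mk V ω hn v w
  rw [← h, LinearMap.nondegenerate_congr_iff]

theorem nondegenerate_pairingB_iff (hn : IsNormalized V (q := 1) ω) :
    (pairingB V ω hn).Nondegenerate ↔ (degenForm ω + (degenForm ω).flip).Nondegenerate := by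
  let e := Submodule.quotientEquivOfIsCompl _ _ (isCompl_cplx1_degenerate (V := V)).symm
  have h : e.arrowCongr (e.arrowCongr (LinearEquiv.refl ℝ ℝ)) (pairingB V ω hn)
      = degenForm ω + (degenForm ω).flip := LinearMap.ext₂ fun u u' => pairingB_mk V ω hn u u'
  rw [← LinearMap.nondegenerate_congr_iff e e, h]

end Forms

theorem C41_eq_unitPairing (X : ConstSymp2Groupoid.{u}) (v : cplx0 X.V) (w : cplx2 X.V) :
    C41 X v w = unitPairing X.ω v w := by
  simp [C41, assemble, unitPairing_apply]

theorem C32_eq_degenForm (X : ConstSymp2Groupoid.{u}) (u u' : cplx1 X.V) :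
    C32 X u u' = degenForm X.ω u u' := by
  simp [C32, assemble, X.isNormalized.apply 1, degenForm_apply]

/-! ### The constant symplectic 2-groupoid of a tuple -/

theorem form_adjointMap {W₁ W₀ : Type u} [AddCommGroup W₁] [Module ℝ W₁]
    [FiniteDimensional ℝ W₁] [AddCommGroup W₀] [Module ℝ W₀] (b : LinearMap.BilinForm ℝ W₁)
    (hb : b.Nondegenerate) (d : W₁ →ₗ[ℝ] W₀) (ξ : Module.Dual ℝ W₀) (u : W₁) :
    b (adjointMap b hb d ξ) u = ξ (d u) :=
  LinearMap.BilinForm.apply_toDual_symm_apply (hB := hb) (d.dualMap ξ) u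

namespace LinearData

variable (T : LinearData.{u})

theorem form_bdryStar (ξ : Module.Dual ℝ T.W₀) (u : T.W₁) :
    T.form (T.bdryStar ξ) u = ξ (T.bdry u) :=
  form_adjointMap _ _ _ _ _

theorem form_comm (x y : T.W₁) : T.form x y = T.form y x := T.form_symm.eq x y

theorem neg_r (x y : T.W₁) : -T.r x y = T.r y x := LinearMap.BilinForm.IsAlt.neg_eq T.r_isAlt x y

theorem r_self (x : T.W₁) : T.r x x = 0 := LinearMap.BilinForm.IsAlt.self_eq_zero T.r_isAlt x

theorem bdry_bdryStar (ξ : Module.Dual ℝ T.W₀) : T.bdry (T.bdryStar ξ) = 0 := by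
  rw [← Module.forall_dual_apply_eq_zero_iff ℝ]
  intro η
  rw [← form_bdryStar]
  exact T.isotropic _ ⟨η, rfl⟩ _ ⟨ξ, rfl⟩

end LinearData

namespace Labelling

variable {V : SimplicialVS.{u}} {T : LinearData.{u}} (L : Labelling V T.bdry T.bdryStar)

/-- The 2-form attached to a labelling of the simplices of `V` by a tuple: in terms of the vertex
labels `xᵢ`, the edge labels `xᵢⱼ` and the triangle label `t(x)` of `x` it is
`r(x₀₂, y₀₂) - r(x₀₁, y₀₁) - r(x₁₂, y₁₂)
  + ½ (⟨x₀₁, y₁₂⟩ - ⟨y₀₁, x₁₂⟩ + t(y)(x₀ + x₂) - t(x)(y₀ + y₂))`. -/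
noncomputable def twoForm : LinearMap.BilinForm ℝ (V _⦋2⦌) :=
  let e (i : Fin 3) := L.edge ∘ₗ face V (q := 1) i
  let ends := L.vert ∘ₗ (face V (q := 0) 1 ∘ₗ face V (q := 1) 1
    + face V (q := 0) 0 ∘ₗ face V (q := 1) 0)
  let A := T.form.compl₁₂ (e 2) (e 0) - L.tri.compl₁₂ LinearMap.id ends
  T.r.compl₁₂ (e 1) (e 1) - T.r.compl₁₂ (e 2) (e 2) - T.r.compl₁₂ (e 0) (e 0)
    + (1 / 2 : ℝ) • (A - A.flip)

theorem twoForm_apply (x y : V _⦋2⦌) : L.twoForm x y =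
    T.r (L.edge (face V (q := 1) 1 x)) (L.edge (face V (q := 1) 1 y))
      - T.r (L.edge (face V (q := 1) 2 x)) (L.edge (face V (q := 1) 2 y))
      - T.r (L.edge (face V (q := 1) 0 x)) (L.edge (face V (q := 1) 0 y))
      + 1 / 2 * (T.form (L.edge (face V (q := 1) 2 x)) (L.edge (face V (q := 1) 0 y))
        - T.form (L.edge (face V (q := 1) 2 y)) (L.edge (face V (q := 1) 0 x))
        + L.tri y (L.vert (face V (q := 0) 1 (face V (q := 1) 1 x))
          + L.vert (face V (q := 0) 0 (face V (q := 1) 0 x)))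
        - L.tri x (L.vert (face V (q := 0) 1 (face V (q := 1) 1 y))
          + L.vert (face V (q := 0) 0 (face V (q := 1) 0 y)))) := by
  simp only [twoForm, LinearMap.add_apply, LinearMap.sub_apply, LinearMap.smul_apply,
    LinearMap.compl₁₂_apply, LinearMap.comp_apply, LinearMap.id_apply, LinearMap.flip_apply,
    map_add, smul_eq_mul]
  ring

theorem twoForm_isAlt : L.twoForm.IsAlt := fun x => by
  rw [twoForm_apply, T.r_self, T.r_self, T.r_self]
  ring

theorem form_edge_eq (x : V _⦋2⦌) (e : V _⦋1⦌) :
    T.form (L.edge (face V (q := 1) 2 x)) (L.edge e)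
      + T.form (L.edge (face V (q := 1) 0 x)) (L.edge e)
      - T.form (L.edge (face V (q := 1) 1 x)) (L.edge e)
      = L.tri x (L.vert (face V (q := 0) 0 e)) - L.tri x (L.vert (face V (q := 0) 1 e)) := by
  rw [← LinearMap.add_apply, ← map_add, ← LinearMap.sub_apply, ← map_sub, ← L.bdry_tri,
    T.form_bdryStar, L.bdry_edge, map_sub]

theorem twoForm_isMultiplicative : IsMultiplicative V (q := 2) L.twoForm := by
  refine isMultiplicative_iff.2 fun x y => ?_
  have h (a b : V _⦋3⦌) := L.form_edge_eq (face V (q := 2) 3 a)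
    (face V (q := 1) 0 (face V (q := 2) 0 b))
  have h' (a b : V _⦋3⦌) := L.form_edge_eq (face V (q := 2) 0 a)
    (face V (q := 1) 2 (face V (q := 2) 2 b))
  have c (a b : V _⦋3⦌) := LinearMap.congr_fun (L.cocycle a)
    (L.vert (face V (q := 0) 1 (face V (q := 1) 1 (face V (q := 2) 1 b)))
      + L.vert (face V (q := 0) 0 (face V (q := 1) 0 (face V (q := 2) 0 b))))
  simp only [LinearMap.add_apply, LinearMap.sub_apply, LinearMap.zero_apply] at c
  simp -index only [twoForm_apply, face_zero_face_one, face_zero_face_two, face_zero_face_three,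
    face_one_face_two, face_one_face_three, face_two_face_three, map_add,
    T.form_comm _ (L.edge (face V (q := 1) 2 (face V (q := 2) 2 _)))] at h h' c ⊢
  linear_combination 1 / 2 * (h x y - h y x + h' x y - h' y x - c x y + c y x)

theorem twoForm_isNormalized : IsNormalized V (q := 1) L.twoForm := by
  intro i
  ext x y
  change L.twoForm (degen V (q := 1) i x) (degen V (q := 1) i y) = 0
  rw [twoForm_apply]
  match i with
  | 0 =>
    simp -index only [L.tri_degen, face_zero_degen_zero, face_one_degen_zero, face_two_degen_zero,
      L.edge_degen, map_zero, LinearMap.zero_apply]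
    ring
  | 1 =>
    simp -index only [L.tri_degen, face_zero_degen_one, face_one_degen_one, face_two_degen_one,
      L.edge_degen, map_zero, LinearMap.zero_apply]
    ring

theorem unitPairing_twoForm (v : cplx0 V) (w : cplx2 V) :
    unitPairing L.twoForm v w = L.tri w (L.vert v) := by
  simp -index only [unitPairing_apply, twoForm_apply, L.tri_degen, face_zero_degen_zero,
    face_one_degen_zero, face_two_degen_zero, L.edge_degen, map_zero, map_add,
    LinearMap.zero_apply]
  ring

theorem degenForm_twoForm (u u' : cplx1 V) :
    degenForm L.twoForm u u'
      = 1 / 2 * T.form (L.edge u) (L.edge u') + T.r (L.edge u) (L.edge u') := by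
  simp -index only [degenForm_apply, twoForm_apply, L.tri_degen, face_zero_degen_zero,
    face_one_degen_zero, face_two_degen_zero, face_zero_degen_one, face_one_degen_one,
    face_two_degen_one, L.edge_degen, map_zero, LinearMap.zero_apply]
  ring

theorem degenForm_twoForm_add_flip (u u' : cplx1 V) :
    degenForm L.twoForm u u' + degenForm L.twoForm u' u = T.form (L.edge u) (L.edge u') := by
  rw [degenForm_twoForm, degenForm_twoForm, ← T.neg_r (L.edge u), T.form_comm (L.edge u')]
  ring

theorem twoForm_toNerve (x y : V _⦋2⦌) :
    (nerveLabelling T.bdry T.bdryStar).twoForm (appLin L.toNerve 2 x) (appLin L.toNerve 2 y)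
      = L.twoForm x y := by
  simp only [twoForm_apply, face_appLin, vert_toNerve, edge_toNerve, tri_toNerve]

end Labelling

namespace LinearData

variable (T : LinearData.{u})

theorem nondegenerate_unitPairing_twoForm :
    (unitPairing (nerveLabelling T.bdry T.bdryStar).twoForm).Nondegenerate := by
  have h : unitPairing (nerveLabelling T.bdry T.bdryStar).twoForm
      = (nerveEquiv0 T.bdry T.bdryStar).symm.arrowCongr
        ((nerveEquiv2 T.bdry_bdryStar).symm.arrowCongr (LinearEquiv.refl ℝ ℝ))
        (Module.Dual.eval ℝ T.W₀) :=
    LinearMap.ext₂ fun v w => Labelling.unitPairing_twoForm _ v w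
  rw [h, LinearMap.nondegenerate_congr_iff]
  exact LinearMap.eval_nondegenerate

theorem nondegenerate_degenForm_twoForm :
    (degenForm (nerveLabelling T.bdry T.bdryStar).twoForm
      + (degenForm (nerveLabelling T.bdry T.bdryStar).twoForm).flip).Nondegenerate := by
  have h : degenForm (nerveLabelling T.bdry T.bdryStar).twoForm
      + (degenForm (nerveLabelling T.bdry T.bdryStar).twoForm).flip
      = (nerveEquiv1 T.bdry T.bdryStar).symm.arrowCongr
        ((nerveEquiv1 T.bdry T.bdryStar).symm.arrowCongr (LinearEquiv.refl ℝ ℝ)) T.form :=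
    LinearMap.ext₂ fun u u' => Labelling.degenForm_twoForm_add_flip _ u u'
  rw [h]
  exact (LinearMap.nondegenerate_congr_iff _ _).2 T.form_nondegenerate

/-- The constant symplectic 2-groupoid of a tuple: the nerve of `W_0^* → W_1 → W_0`. -/
noncomputable def groupoid : ConstSymp2Groupoid.{u} where
  V := nerve T.bdry T.bdryStar
  isLinearGroupoid := isLinearGroupoid_nerve
  ω := (nerveLabelling T.bdry T.bdryStar).twoForm
  isAlt := Labelling.twoForm_isAlt _
  isMultiplicative := Labelling.twoForm_isMultiplicative _
  isNormalized := Labelling.twoForm_isNormalized _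
  nondegenerate_A := (nondegenerate_pairingA_iff _).2 T.nondegenerate_unitPairing_twoForm
  nondegenerate_B := (nondegenerate_pairingB_iff _).2 T.nondegenerate_degenForm_twoForm

/-- The tautological presentation of the groupoid of a tuple by that tuple. -/
noncomputable def presentation : Presentation T.groupoid T where
  e₀ := nerveEquiv0 T.bdry T.bdryStar
  e₁ := nerveEquiv1 T.bdry T.bdryStar
  e₂ := nerveEquiv2 T.bdry_bdryStar
  map_bdry1 := (nerveLabelling T.bdry T.bdryStar).vert_bdry1
  map_bdry2 := (nerveLabelling T.bdry T.bdryStar).edge_bdry2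
  map_C41 v w := (C41_eq_unitPairing _ v w).trans (Labelling.unitPairing_twoForm _ v w)
  map_C32 u u' := (C32_eq_degenForm _ u u').trans (Labelling.degenForm_twoForm _ u u')

end LinearData

/-! ### Presented groupoids -/

namespace Presentation

variable {X : ConstSymp2Groupoid.{u}} {S : LinearData.{u}}

theorem form_apply (φ : Presentation X S) (u u' : cplx1 X.V) :
    S.form (φ.e₁ u) (φ.e₁ u') = C32 X u u' + C32 X u' u := by
  rw [φ.map_C32, φ.map_C32, S.form_comm (φ.e₁ u'), ← S.neg_r (φ.e₁ u)]
  ring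

theorem r_apply (φ : Presentation X S) (u u' : cplx1 X.V) :
    S.r (φ.e₁ u) (φ.e₁ u') = 1 / 2 * (C32 X u u' - C32 X u' u) := by
  rw [φ.map_C32, φ.map_C32, S.form_comm (φ.e₁ u'), ← S.neg_r (φ.e₁ u)]
  ring

/-- The labelling of the simplices of a presented groupoid by its tuple. -/
noncomputable def labelling (φ : Presentation X S) : Labelling X.V S.bdry S.bdryStar :=
  .ofComplexMap X.isLinearGroupoid φ.e₀.toLinearMap φ.e₁.toLinearMap φ.e₂.toLinearMap φ.map_bdry1
    φ.map_bdry2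

theorem vert_labelling (φ : Presentation X S) (v : cplx0 X.V) : φ.labelling.vert v = φ.e₀ v := rfl

theorem edge_labelling (φ : Presentation X S) (u : cplx1 X.V) : φ.labelling.edge u = φ.e₁ u :=
  congrArg φ.e₁ (proj1_coe u)

theorem tri_labelling (φ : Presentation X S) (w : cplx2 X.V) : φ.labelling.tri w = φ.e₂ w :=
  congrArg φ.e₂ (proj2_coe w)

theorem ω_eq_twoForm (φ : Presentation X S) : X.ω = φ.labelling.twoForm := by
  refine eq_of_unitPairing_eq_of_degenForm_eq X.isMultiplicative
    (Labelling.twoForm_isMultiplicative _) X.isNormalized (Labelling.twoForm_isNormalized _)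
    X.isAlt (Labelling.twoForm_isAlt _) (LinearMap.ext₂ fun v w => ?_)
    (LinearMap.ext₂ fun u u' => ?_)
  · rw [Labelling.unitPairing_twoForm, tri_labelling, vert_labelling, ← C41_eq_unitPairing,
      φ.map_C41]
  · rw [Labelling.degenForm_twoForm, edge_labelling, edge_labelling, ← C32_eq_degenForm,
      φ.map_C32]

theorem e₀_toNerve (φ : Presentation X S) (v : cplx0 X.V) :
    S.presentation.e₀ (appLin φ.labelling.toNerve 0 v) = φ.e₀ v :=
  φ.labelling.vert_toNerve v

theorem e₁_toNerve (φ : Presentation X S) (u : cplx1 X.V) :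
    S.presentation.e₁ (cplx1Map φ.labelling.toNerve u) = φ.e₁ u :=
  (φ.labelling.edge_toNerve u).trans (φ.edge_labelling u)

theorem e₂_toNerve (φ : Presentation X S) (w : cplx2 X.V) :
    S.presentation.e₂ (cplx2Map φ.labelling.toNerve w) = φ.e₂ w :=
  (φ.labelling.tri_toNerve w).trans (φ.tri_labelling w)

theorem bijective_toNerve (φ : Presentation X S) (q : ℕ) :
    Function.Bijective (appLin φ.labelling.toNerve q) := by
  refine X.isLinearGroupoid.bijective_appLin S.groupoid.isLinearGroupoid ?_ ?_ ?_ q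
  · rw [← Function.Bijective.of_comp_iff' S.presentation.e₀.bijective]
    exact (funext φ.e₀_toNerve : _ ∘ _ = φ.e₀) ▸ φ.e₀.bijective
  · rw [← Function.Bijective.of_comp_iff' S.presentation.e₁.bijective]
    exact (funext φ.e₁_toNerve : _ ∘ _ = φ.e₁) ▸ φ.e₁.bijective
  · rw [← Function.Bijective.of_comp_iff' S.presentation.e₂.bijective]
    exact (funext φ.e₂_toNerve : _ ∘ _ = φ.e₂) ▸ φ.e₂.bijective

/-- The isomorphism of a presented groupoid with the groupoid of its tuple. -/
noncomputable def groupoidIso (φ : Presentation X S) : SympIso X S.groupoid where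
  iso := isoOfBijective φ.labelling.toNerve φ.bijective_toNerve
  map_ω x y := (φ.labelling.twoForm_toNerve x y).trans (by rw [φ.ω_eq_twoForm])

theorem e₀_groupoidIso (φ : Presentation X S) (v : cplx0 X.V) :
    S.presentation.e₀ (φ.groupoidIso.app 0 v) = φ.e₀ v :=
  φ.e₀_toNerve v

theorem e₁_groupoidIso (φ : Presentation X S) (u : cplx1 X.V) :
    S.presentation.e₁ (φ.groupoidIso.app1 u) = φ.e₁ u :=
  φ.e₁_toNerve u

end Presentation

/-! ### Isomorphisms of groupoids and of tuples -/

namespace SympIso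

variable {X Y Z : ConstSymp2Groupoid.{u}}

theorem app_inv_app (f : SympIso X Y) (q : ℕ) (y : Y.V _⦋q⦌) :
    f.app q (appLin f.iso.inv q y) = y :=
  congrArg (fun g => g.hom y) (f.iso.inv_hom_id_app (op ⦋q⦌))

theorem inv_app_app (f : SympIso X Y) (q : ℕ) (x : X.V _⦋q⦌) :
    appLin f.iso.inv q (f.app q x) = x :=
  congrArg (fun g => g.hom x) (f.iso.hom_inv_id_app (op ⦋q⦌))

/-- The inverse of an isomorphism. -/
def symm (f : SympIso X Y) : SympIso Y X where
  iso := f.iso.symm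
  map_ω x y := by
    have h := f.map_ω (appLin f.iso.inv 2 x) (appLin f.iso.inv 2 y)
    exact h.symm.trans (congrArg₂ (Y.ω · ·) (f.app_inv_app 2 x) (f.app_inv_app 2 y))

/-- The composition of isomorphisms. -/
def trans (f : SympIso X Y) (g : SympIso Y Z) : SympIso X Z where
  iso := f.iso ≪≫ g.iso
  map_ω x y := (g.map_ω _ _).trans (f.map_ω x y)

/-- The linear isomorphism in degree `q`. -/
def appEquiv (f : SympIso X Y) (q : ℕ) : X.V _⦋q⦌ ≃ₗ[ℝ] Y.V _⦋q⦌ :=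
  .ofLinearMap (f.app q) (appLin f.iso.inv q) (LinearMap.ext (f.app_inv_app q))
    (LinearMap.ext (f.inv_app_app q))

/-- The linear isomorphism of `W_1`. -/
def app1Equiv (f : SympIso X Y) : cplx1 X.V ≃ₗ[ℝ] cplx1 Y.V :=
  .ofLinearMap f.app1 (cplx1Map f.iso.inv)
    (LinearMap.ext fun u => Subtype.ext (f.app_inv_app 1 u))
    (LinearMap.ext fun u => Subtype.ext (f.inv_app_app 1 u))

theorem bdry1_app1 (f : SympIso X Y) (u : cplx1 X.V) :
    bdry1 Y.V (f.app1 u) = f.app 0 (bdry1 X.V u) :=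
  (congrArg (- ·) (face_appLin f.iso.hom 1 u.1)).trans (map_neg (f.app 0) _).symm

theorem C41_map (f : SympIso X Y) (v : cplx0 X.V) (w : cplx2 X.V) :
    C41 Y (f.app 0 v) (cplx2Map f.iso.hom w) = C41 X v w := by
  rw [C41_eq_unitPairing, C41_eq_unitPairing, unitPairing_apply, unitPairing_apply, coe_cplx2Map,
    degen_appLin f.iso.hom (q := 0), degen_appLin f.iso.hom (q := 1)]
  exact f.map_ω _ _

theorem C32_map (f : SympIso X Y) (u u' : cplx1 X.V) :
    C32 Y (f.app1 u) (f.app1 u') = C32 X u u' := by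
  change C32 Y (cplx1Map f.iso.hom u) (cplx1Map f.iso.hom u') = _
  rw [C32_eq_degenForm, C32_eq_degenForm, degenForm_apply, degenForm_apply, coe_cplx1Map,
    coe_cplx1Map, degen_appLin f.iso.hom (q := 1), degen_appLin f.iso.hom (q := 1)]
  exact f.map_ω _ _

end SympIso

section Matching

variable {X Y : ConstSymp2Groupoid.{u}} {S T : LinearData.{u}}

theorem DataIso.map_bdryStar (g : DataIso S T) (ξ : Module.Dual ℝ S.W₀) :
    g.e₁ (S.bdryStar ξ) = T.bdryStar (g.e₀.symm.dualMap ξ) := by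
  rw [← sub_eq_zero]
  refine T.form_nondegenerate.1 _ fun u => ?_
  obtain ⟨u, rfl⟩ := g.e₁.surjective u
  rw [map_sub, LinearMap.sub_apply, g.map_form, S.form_bdryStar, T.form_bdryStar, g.map_bdry,
    LinearEquiv.dualMap_apply, LinearEquiv.symm_apply_apply, sub_self]

/-- The transport of a presentation along an isomorphism of tuples. -/
def Presentation.trans (φ : Presentation X S) (g : DataIso S T) : Presentation X T where
  e₀ := φ.e₀.trans g.e₀
  e₁ := φ.e₁.trans g.e₁
  e₂ := φ.e₂.trans g.e₀.symm.dualMap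
  map_bdry1 u := by
    rw [LinearEquiv.trans_apply, LinearEquiv.trans_apply, φ.map_bdry1, g.map_bdry]
  map_bdry2 w := by
    rw [LinearEquiv.trans_apply, LinearEquiv.trans_apply, φ.map_bdry2, g.map_bdryStar]
  map_C41 v w := by simp [φ.map_C41]
  map_C32 u u' := by simp only [LinearEquiv.trans_apply, φ.map_C32, g.map_form, g.map_r]

theorem exists_sympIso_matches (φ : Presentation X S) (ψ : Presentation Y T) (g : DataIso S T) :
    ∃ f : SympIso X Y, Matches φ ψ f g := by
  let χ := φ.trans g
  have h (q : ℕ) (x : X.V _⦋q⦌) :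
      ψ.groupoidIso.app q ((χ.groupoidIso.trans ψ.groupoidIso.symm).app q x)
        = χ.groupoidIso.app q x :=
    ψ.groupoidIso.app_inv_app q _
  refine ⟨χ.groupoidIso.trans ψ.groupoidIso.symm, fun x => ?_, fun u => ?_⟩
  · rw [← ψ.e₀_groupoidIso, h]
    exact χ.e₀_groupoidIso x
  · rw [← ψ.e₁_groupoidIso]
    exact (congrArg T.presentation.e₁ (Subtype.ext (h 1 u))).trans (χ.e₁_groupoidIso u)

theorem Matches.sympIso_unique {φ : Presentation X S} {ψ : Presentation Y T} {f f' : SympIso X Y}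
    {g : DataIso S T} (h : Matches φ ψ f g) (h' : Matches φ ψ f' g) : f = f' := by
  have h₀ : f.app 0 = f'.app 0 :=
    LinearMap.ext fun v => ψ.e₀.injective ((h.1 v).trans (h'.1 v).symm)
  have h₁ : f.app1 = f'.app1 :=
    LinearMap.ext fun u => ψ.e₁.injective ((h.2 u).trans (h'.2 u).symm)
  have h₂ : cplx2Map f.iso.hom = cplx2Map f'.iso.hom := by
    refine LinearMap.ext fun w => ψ.e₂.injective (LinearMap.ext fun v => ?_)
    obtain ⟨v, rfl⟩ := ((f.appEquiv 0).trans ψ.e₀).surjective v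
    change ψ.e₂ _ (ψ.e₀ (f.app 0 v)) = ψ.e₂ _ (ψ.e₀ (f.app 0 v))
    rw [← ψ.map_C41, f.C41_map, h₀, ← ψ.map_C41, f'.C41_map]
  exact SympIso.ext (Iso.ext (X.isLinearGroupoid.hom_ext h₀ h₁ h₂))

/-- The isomorphism of tuples induced by an isomorphism of presented groupoids. -/
def SympIso.toDataIso (φ : Presentation X S) (ψ : Presentation Y T) (f : SympIso X Y) :
    DataIso S T where
  e₁ := φ.e₁.symm.trans (f.app1Equiv.trans ψ.e₁)
  e₀ := φ.e₀.symm.trans ((f.appEquiv 0).trans ψ.e₀)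
  map_form x y := by
    obtain ⟨u, rfl⟩ := φ.e₁.surjective x
    obtain ⟨u', rfl⟩ := φ.e₁.surjective y
    simp only [LinearEquiv.trans_apply, LinearEquiv.symm_apply_apply, ψ.form_apply, φ.form_apply]
    exact congrArg₂ (· + ·) (f.C32_map _ _) (f.C32_map _ _)
  map_bdry x := by
    obtain ⟨u, rfl⟩ := φ.e₁.surjective x
    simp only [LinearEquiv.trans_apply, LinearEquiv.symm_apply_apply, ← φ.map_bdry1,
      ← ψ.map_bdry1]
    exact congrArg ψ.e₀ (f.bdry1_app1 u)
  map_r x y := by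
    obtain ⟨u, rfl⟩ := φ.e₁.surjective x
    obtain ⟨u', rfl⟩ := φ.e₁.surjective y
    simp only [LinearEquiv.trans_apply, LinearEquiv.symm_apply_apply, ψ.r_apply, φ.r_apply]
    exact congrArg (1 / 2 * ·) (congrArg₂ (· - ·) (f.C32_map _ _) (f.C32_map _ _))

theorem SympIso.matches_toDataIso (φ : Presentation X S) (ψ : Presentation Y T)
    (f : SympIso X Y) : Matches φ ψ f (f.toDataIso φ ψ) :=
  ⟨fun v => (congrArg (fun v => ψ.e₀ (f.app 0 v)) (φ.e₀.symm_apply_apply v)).symm,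
    fun u => (congrArg (fun u => ψ.e₁ (f.app1 u)) (φ.e₁.symm_apply_apply u)).symm⟩

theorem Matches.dataIso_unique {φ : Presentation X S} {ψ : Presentation Y T} {f : SympIso X Y}
    {g g' : DataIso S T} (h : Matches φ ψ f g) (h' : Matches φ ψ f g') : g = g' := by
  refine DataIso.ext (LinearEquiv.ext fun x => ?_) (LinearEquiv.ext fun x => ?_)
  · obtain ⟨u, rfl⟩ := φ.e₁.surjective x
    rw [← h.2, ← h'.2]
  · obtain ⟨v, rfl⟩ := φ.e₀.surjective x
    rw [← h.1, ← h'.1]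

end Matching

/-! ### The tuple of a constant symplectic 2-groupoid -/

namespace ConstSymp2Groupoid

variable (X : ConstSymp2Groupoid.{u})

instance (q : ℕ) : FiniteDimensional ℝ (X.V _⦋q⦌) := X.isLinearGroupoid.finiteDimensional q

/-- The symmetric form on `W_1`: the symmetrization of `C₃₂`. -/
def symForm : LinearMap.BilinForm ℝ (cplx1 X.V) := degenForm X.ω + (degenForm X.ω).flip

theorem symForm_apply (u u' : cplx1 X.V) :
    X.symForm u u' = degenForm X.ω u u' + degenForm X.ω u' u := rfl

theorem symForm_comm (u u' : cplx1 X.V) : X.symForm u u' = X.symForm u' u := by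
  rw [symForm_apply, symForm_apply, add_comm]

theorem symForm_nondegenerate : X.symForm.Nondegenerate :=
  (nondegenerate_pairingB_iff X.isNormalized).1 X.nondegenerate_B

theorem unitPairing_flip_bijective : Function.Bijective (unitPairing X.ω).flip := by
  have h := (nondegenerate_pairingA_iff X.isNormalized).1 X.nondegenerate_A
  have := LinearMap.IsPerfPair.of_injective (p := (unitPairing X.ω).flip)
    (LinearMap.separatingRight_iff_flip_ker_eq_bot.1 h.2 |> LinearMap.ker_eq_bot.1)
    (LinearMap.separatingLeft_iff_ker_eq_bot.1 h.1 |> LinearMap.ker_eq_bot.1)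
  exact LinearMap.IsPerfPair.bijective_left _

/-- The isomorphism of `W_2` with the dual of `W_0` given by `C₄₁`. -/
noncomputable def dualEquiv : cplx2 X.V ≃ₗ[ℝ] Module.Dual ℝ (cplx0 X.V) :=
  .ofBijective _ X.unitPairing_flip_bijective

theorem dualEquiv_apply (w : cplx2 X.V) (v : cplx0 X.V) :
    X.dualEquiv w v = unitPairing X.ω v w := rfl

theorem symForm_bdry2 (w : cplx2 X.V) (u : cplx1 X.V) :
    X.symForm (bdry2 X.V w) u = X.dualEquiv w (bdry1 X.V u) := by
  have h₀ := X.isMultiplicative.cplx2_apply_degen_zero w u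
  have h₁ := X.isMultiplicative.cplx2_apply_degen_one w u
  have h := X.isMultiplicative.cplx2_apply_degen_sub w u
  have e₀ := X.isAlt.neg_eq w.1 (degen X.V (q := 1) 0 (degen X.V (q := 0) 0 (bdry1 X.V u)))
  have e₁ := X.isAlt.neg_eq (degen X.V (q := 1) 0 (bdry2 X.V w).1) (degen X.V (q := 1) 1 u.1)
  rw [symForm_apply, dualEquiv_apply, unitPairing_apply, degenForm_apply, degenForm_apply, ← e₀,
    ← e₁]
  linear_combination h₀ - h₁ - h

theorem adjointMap_dualEquiv (w : cplx2 X.V) :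
    adjointMap X.symForm X.symForm_nondegenerate (bdry1 X.V) (X.dualEquiv w) = bdry2 X.V w := by
  rw [← sub_eq_zero]
  refine X.symForm_nondegenerate.1 _ fun u => ?_
  rw [map_sub, LinearMap.sub_apply, form_adjointMap, symForm_bdry2, sub_self]

/-- The tuple of a constant symplectic 2-groupoid. -/
noncomputable def toLinearData : LinearData.{u} where
  W₁ := cplx1 X.V
  W₀ := cplx0 X.V
  form := X.symForm
  form_symm := ⟨X.symForm_comm⟩
  form_nondegenerate := X.symForm_nondegenerate
  bdry := bdry1 X.V
  isotropic := by
    rintro _ ⟨ξ, rfl⟩ _ ⟨η, rfl⟩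
    obtain ⟨w, rfl⟩ := X.dualEquiv.surjective η
    rw [form_adjointMap, adjointMap_dualEquiv, bdry1_bdry2, map_zero]
  r := (1 / 2 : ℝ) • (degenForm X.ω - (degenForm X.ω).flip)
  r_isAlt u := by simp

/-- The presentation of a constant symplectic 2-groupoid by its tuple. -/
noncomputable def toPresentation : Presentation X X.toLinearData where
  e₀ := LinearEquiv.refl ℝ _
  e₁ := LinearEquiv.refl ℝ _
  e₂ := X.dualEquiv
  map_bdry1 _ := rfl
  map_bdry2 w := (X.adjointMap_dualEquiv w).symm
  map_C41 := C41_eq_unitPairing X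
  map_C32 u u' := by
    change _ = 1 / 2 * X.symForm u u' + 1 / 2 * (degenForm X.ω u u' - degenForm X.ω u' u)
    rw [symForm_apply, C32_eq_degenForm]
    ring

end ConstSymp2Groupoid

/-- The class of the tuple of a constant symplectic 2-groupoid, as a map on isomorphism classes. -/
noncomputable def classMap : Quotient sympSetoid.{u} → Quotient dataSetoid.{u} :=
  Quotient.map ConstSymp2Groupoid.toLinearData fun X Y ⟨f⟩ =>
    ⟨f.toDataIso X.toPresentation Y.toPresentation⟩

theorem classMap_eq_iff (X : ConstSymp2Groupoid.{u}) (T : LinearData.{u}) :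
    classMap (Quotient.mk _ X) = Quotient.mk _ T ↔ Nonempty (Presentation X T) := by
  constructor
  · intro h
    obtain ⟨g⟩ : Nonempty (DataIso X.toLinearData T) := Quotient.exact h
    exact ⟨X.toPresentation.trans g⟩
  · rintro ⟨φ⟩
    exact Quotient.sound (s := dataSetoid)
      ⟨(⟨Iso.refl _, fun _ _ => rfl⟩ : SympIso X X).toDataIso X.toPresentation φ⟩

theorem classMap_bijective : Function.Bijective classMap.{u} := by
  constructor
  · rintro ⟨X⟩ ⟨Y⟩ h
    obtain ⟨g⟩ : Nonempty (DataIso X.toLinearData Y.toLinearData) := Quotient.exact h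
    obtain ⟨f, -⟩ := exists_sympIso_matches X.toPresentation Y.toPresentation g
    exact Quotient.sound (s := sympSetoid) ⟨f⟩
  · rintro ⟨T⟩
    exact ⟨Quotient.mk _ T.groupoid, (classMap_eq_iff _ _).2 ⟨T.presentation⟩⟩

end ConstSymplectic

theorem theorem3p5 :
    (∃ Φ : Quotient ConstSymplectic.sympSetoid.{u} ≃ Quotient ConstSymplectic.dataSetoid.{u},
      ∀ (X : ConstSymplectic.ConstSymp2Groupoid.{u}) (T : ConstSymplectic.LinearData.{u}),
        Φ (Quotient.mk _ X) = Quotient.mk _ T ↔ Nonempty (ConstSymplectic.Presentation X T)) ∧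
    ∀ (X Y : ConstSymplectic.ConstSymp2Groupoid.{u}) (S T : ConstSymplectic.LinearData.{u})
      (φ : ConstSymplectic.Presentation X S) (ψ : ConstSymplectic.Presentation Y T),
      (∀ g : ConstSymplectic.DataIso S T,
        ∃! f : ConstSymplectic.SympIso X Y, ConstSymplectic.Matches φ ψ f g) ∧
      (∀ f : ConstSymplectic.SympIso X Y,
        ∃! g : ConstSymplectic.DataIso S T, ConstSymplectic.Matches φ ψ f g) := by
  refine ⟨⟨Equiv.ofBijective _ ConstSymplectic.classMap_bijective,
    ConstSymplectic.classMap_eq_iff⟩, fun X Y S T φ ψ => ⟨fun g => ?_, fun f => ?_⟩⟩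
  · obtain ⟨f, hf⟩ := ConstSymplectic.exists_sympIso_matches φ ψ g
    exact ⟨f, hf, fun f' hf' => hf'.sympIso_unique hf⟩
  · exact ⟨f.toDataIso φ ψ, f.matches_toDataIso φ ψ,
      fun g' hg' => hg'.dataIso_unique (f.matches_toDataIso φ ψ)⟩
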